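/- **Theorem 3.5.** Let $n\ge 2$, and let $\mathbf P=(p_{ij})$ and $\mathbf S=(s_{ij})$ be symmetric $n\times n$ matrices with entries in $[0,1]$ and zero diagonal. Write $A\sim\mathsf G_n(\mathbf P,\mathbf S)$ for the random signed adjacency matrix obtained as follows: for each pair $i<j$ let $E_{ij}\sim\mathrm{Bernoulli}(p_{ij})$ (edge present) and $S_{ij}\sim\mathrm{Bernoulli}(s_{ij})$ (negative sign), all these variables being mutually independent, and put $a_{ij}=a_{ji}=E_{ij}(1-2S_{ij})$, $a_{ii}=0$. Let $D=\mathrm{diag}(d_1,\dots,d_n)$ with degrees $d_i=\sum_j|a_{ij}|$, and let $\mathcal L=D^{-1/2}(D-A)D^{-1/2}$ be the normalized signed Laplacian, where $(D^{-1/2})_{ii}=0$ if $d_i=0$. Put $\overline a_{ij}=p_{ij}(1-2s_{ij})$, $\overline A=(\overline a_{ij})$, $\overline d_i=\sum_j p_{ij}$, $\overline D=\mathrm{diag}(\overline d_1,\dots,\overline d_n)$ and $\overline{\mathcal L}=\overline D^{-1/2}(\overline D-\overline A)\overline D^{-1/2}$ (same convention for $\overline D^{-1/2}$). Let $d_{\min}=\min_i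 d_i$ be the (random) minimum degree and $\overline d_{\min}=\min_i\overline d_i$ the minimum expected degree, and let $\|\cdot\|_{\mathrm{op}}$ be the spectral norm. For all real $c_0,c_1,r>0$ there are $C=C(c_0,c_1,r)>0$ and $N=N(c_0,c_1,r)$ such that the following holds for all $n\ge\max\{2,N\}$, all $\mathbf P,\mathbf S$ as above and all real $\alpha$. If $$\min_{i,j}|s_{ij}-\tfrac12|>c_0,\qquad n\max_{i,j}|\overline a_{ij}|\le\alpha,\qquad \alpha\ge c_1\log n,$$ and $A\sim\mathsf G_n(\mathbf P,\mathbf S)$, then with probability at least $1-n^{-r}$ $$\|\mathcal L-\overline{\mathcal L}\|_{\mathrm{op}}\le\frac{C\,\alpha^{5/2}}{\min\{d_{\min},\overline d_{\min}\}^3},$$ where the right-hand side is read as $+\infty$ if $\min\{d_{\min},\overline d_{\min}\}=0$. -/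

import Mathlib

open MeasureTheory ProbabilityTheory

noncomputable section

namespace SignedER

/-- The product (equivalently Borel) σ-algebra on real matrices, measurability of all entries. -/
instance matrixMeasurableSpace (n : ℕ) : MeasurableSpace (Matrix (Fin n) (Fin n) ℝ) :=
  inferInstanceAs (MeasurableSpace (Fin n → Fin n → ℝ))

/-- The unordered pairs `{i, j}` of distinct nodes of `[n]`, listed as ordered pairs `i < j`. -/
abbrev Pair (n : ℕ) : Type := {e : Fin n × Fin n // e.1 < e.2}

/-- The entry `P (1 - 2 S)` given by an edge indicator `P` and a negative-sign indicator `S`: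
`0` without an edge, `1` for a positive edge, `-1` for a negative edge. -/
def entry (b : Bool × Bool) : ℝ :=
  (if b.1 then 1 else 0) * (1 - 2 * (if b.2 then 1 else 0))

/-- The signed adjacency matrix of the signed graph whose edge and sign indicators are `x`. -/
def adjacency {n : ℕ} (x : Pair n → Bool × Bool) : Matrix (Fin n) (Fin n) ℝ :=
  Matrix.of fun i j =>
    if h : i < j then entry (x ⟨(i, j), h⟩)
    else if h : j < i then entry (x ⟨(j, i), h⟩)
    else 0

/-- The joint law of all the edge and sign indicators: mutually independent Bernoulli variables,
with parameter `P i j` for the edge `{i, j}` and `S i j` for its negative sign. -/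
def indicatorLaw {n : ℕ} (P S : Matrix (Fin n) (Fin n) unitInterval) :
    Measure (Pair n → Bool × Bool) :=
  Measure.pi fun e =>
    (bernoulliMeasure true false (P e.1.1 e.1.2)).prod
      (bernoulliMeasure true false (S e.1.1 e.1.2))

/-- The signed inhomogeneous Erdős–Rényi model `G_n(P, S)`, as a law on matrices. -/
def model {n : ℕ} (P S : Matrix (Fin n) (Fin n) unitInterval) :
    Measure (Matrix (Fin n) (Fin n) ℝ) :=
  (indicatorLaw P S).map adjacency

/-- `(P, S)` are admissible parameters: symmetric matrices of probabilities with zero diagonal. -/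
structure Admissible {n : ℕ} (P S : Matrix (Fin n) (Fin n) unitInterval) : Prop where
  symm_edge : P.IsSymm
  symm_sign : S.IsSymm
  diag_edge : ∀ i, P i i = 0
  diag_sign : ∀ i, S i i = 0

/-- The mean signed adjacency matrix, with entries `p_ij (1 - 2 s_ij)`. -/
def meanAdjacency {n : ℕ} (P S : Matrix (Fin n) (Fin n) unitInterval) :
    Matrix (Fin n) (Fin n) ℝ :=
  Matrix.of fun i j => (P i j : ℝ) * (1 - 2 * (S i j : ℝ))

/-- The degrees `|A| 1` of a signed graph with signed adjacency matrix `A`. -/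
def degree {n : ℕ} (A : Matrix (Fin n) (Fin n) ℝ) (i : Fin n) : ℝ := ∑ j, |A i j|

/-- The expected degrees `P 1`. -/
def meanDegree {n : ℕ} (P : Matrix (Fin n) (Fin n) unitInterval) (i : Fin n) : ℝ :=
  ∑ j, (P i j : ℝ)

/-- `D^{-1/2} (D - A) D^{-1/2}` for `D = diag d`, where the `i`-th diagonal entry of `D^{-1/2}`
is `0` if `d i = 0`. -/
def normalizedLaplacian {n : ℕ} (d : Fin n → ℝ) (A : Matrix (Fin n) (Fin n) ℝ) :
    Matrix (Fin n) (Fin n) ℝ :=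
  Matrix.diagonal (fun i => (√(d i))⁻¹) * (Matrix.diagonal d - A) *
    Matrix.diagonal (fun i => (√(d i))⁻¹)

/-- The normalized signed Laplacian of a signed graph with signed adjacency matrix `A`. -/
def laplacian {n : ℕ} (A : Matrix (Fin n) (Fin n) ℝ) : Matrix (Fin n) (Fin n) ℝ :=
  normalizedLaplacian (degree A) A

/-- The degree-normalized mean Laplacian. -/
def meanLaplacian {n : ℕ} (P S : Matrix (Fin n) (Fin n) unitInterval) :
    Matrix (Fin n) (Fin n) ℝ :=
  normalizedLaplacian (meanDegree P) (meanAdjacency P S)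

/-- The spectral norm: the operator norm with respect to the Euclidean norm. -/
def opNorm {n : ℕ} (M : Matrix (Fin n) (Fin n) ℝ) : ℝ :=
  ‖Matrix.toEuclideanCLM (n := Fin n) (𝕜 := ℝ) M‖

/-- The minimum degree (used for `n ≥ 1` only). -/
def minDegree {n : ℕ} (A : Matrix (Fin n) (Fin n) ℝ) : ℝ := ⨅ i, degree A i

/-- The minimum expected degree (used for `n ≥ 1` only). -/
def minMeanDegree {n : ℕ} (P : Matrix (Fin n) (Fin n) unitInterval) : ℝ := ⨅ i, meanDegree P i

end SignedER

end

/-!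
The difference of the two Laplacians splits (`normalizedLaplacian_sub`) into
`D^{-1/2} (A - Ā) D^{-1/2}`, of norm at most `‖A - Ā‖ / m` with `m` the smaller of the two minimum
degrees, and a matrix with entries `ā_ij (1 / √(d_i d_j) - 1 / √(d̄_i d̄_j))`. As `|ā_ij| ≤ α / n`,
the Hilbert–Schmidt norm of the latter is at most `α Δ V / m ^ 3`, where `Δ` bounds all degrees and
`n V ^ 2` bounds `∑ (d_i - d̄_i) ^ 2`. Both `Δ` and `V` are controlled by the spectral norm of
`F = |A| - P`: the vector of degree deviations is `F 1`, and `d_i = ∑ j, |a_ij| ^ 2` is the square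
of the norm of a column of `F + P`. Hence everything follows once `‖A - Ā‖` and `‖|A| - P‖` are both
`O(√α)` with probability `1 - O(n ^ (-r))`. The sign condition enters through
`p_ij ≤ |ā_ij| / (2 c₀)`, which gives variances of order `α / n`.

The norm bound is a moment estimate of order `2 k` with `k = ⌈α⌉`. The trace of the `2 k`-th power
of a symmetric matrix `W` with independent centred entries is a sum over closed walks, and only
doubled walks (every edge traversed at least twice) have nonzero expectation; a walk with `m`
vertices contributes at most `4 ^ k q ^ (m - 1)`, where `q` bounds the variances
(`abs_integral_prod_walk_le`). Rather than enumerating the shapes of walks, they are compared, shape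
by shape, with the walks on `R` vertices, where `R` is a multiple of `k` of size at least `k + n q`
(`sum_isDoubled_le`), in the manner of Bandeira and van Handel. The number of doubled walks on `R`
vertices is in turn at most the trace moment of an `R × R` symmetric matrix with independent entries
uniform on the multiset `{2, -1, -1}`: this variable has mean `0` and all its higher moments are at
least `1` (`card_isDoubled_le_sum_trace`). That dense matrix is subgaussian, so a net argument
bounds its moments by `(C k) ^ k` (`card_isDoubled_le`). Since `k ≥ c₁ log n`, the dimensional
factor `n` is absorbed by Markov's inequality.
-/

namespace SignedER

/-! ### The spectral norm: trace moments and nets -/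

open scoped Matrix.Norms.L2Operator in
lemma opNorm_eq_norm {n : ℕ} (M : Matrix (Fin n) (Fin n) ℝ) : opNorm M = ‖M‖ := by
  rw [opNorm, Matrix.l2_opNorm_toEuclideanCLM]

lemma opNorm_nonneg {n : ℕ} (M : Matrix (Fin n) (Fin n) ℝ) : 0 ≤ opNorm M := norm_nonneg _

open scoped Matrix.Norms.L2Operator in
lemma opNorm_mul_le {n : ℕ} (M N : Matrix (Fin n) (Fin n) ℝ) :
    opNorm (M * N) ≤ opNorm M * opNorm N := by
  simp only [opNorm_eq_norm]; exact Matrix.l2_opNorm_mul M N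

open scoped Matrix.Norms.L2Operator in
lemma opNorm_add_le {n : ℕ} (M N : Matrix (Fin n) (Fin n) ℝ) :
    opNorm (M + N) ≤ opNorm M + opNorm N := by
  simp only [opNorm_eq_norm]; exact norm_add_le _ _

open scoped Matrix.Norms.L2Operator in
lemma opNorm_neg {n : ℕ} (M : Matrix (Fin n) (Fin n) ℝ) : opNorm (-M) = opNorm M := by
  simp only [opNorm_eq_norm, norm_neg]

open scoped Matrix.Norms.L2Operator in
lemma opNorm_pow_le {n : ℕ} (M : Matrix (Fin n) (Fin n) ℝ) (k : ℕ) (hk : 0 < k) :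
    opNorm (M ^ k) ≤ opNorm M ^ k := by
  simp only [opNorm_eq_norm]; exact norm_pow_le' _ hk

open scoped Matrix.Norms.L2Operator in
lemma opNorm_diagonal_le {n : ℕ} (d : Fin n → ℝ) {b : ℝ} (hb : 0 ≤ b) (h : ∀ i, |d i| ≤ b) :
    opNorm (Matrix.diagonal d) ≤ b := by
  rw [opNorm_eq_norm, Matrix.l2_opNorm_diagonal, pi_norm_le_iff_of_nonneg hb]
  exact h

/-- The defining inequality of the operator norm, with Euclidean norms written out. -/
lemma sum_mulVec_sq_le {n : ℕ} (M : Matrix (Fin n) (Fin n) ℝ) (x : Fin n → ℝ) :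
    ∑ i, (M.mulVec x i) ^ 2 ≤ opNorm M ^ 2 * ∑ i, x i ^ 2 := by
  have h := (Matrix.toEuclideanCLM (n := Fin n) (𝕜 := ℝ) M).le_opNorm (WithLp.toLp 2 x)
  have h2 := pow_le_pow_left₀ (norm_nonneg _) h 2
  rw [mul_pow, EuclideanSpace.norm_sq_eq, EuclideanSpace.norm_sq_eq] at h2
  simpa [opNorm, Matrix.toEuclideanCLM_toLp] using h2

/-- The spectral norm is at most the Hilbert–Schmidt norm. -/
lemma opNorm_sq_le_sum_sq {n : ℕ} (M : Matrix (Fin n) (Fin n) ℝ) :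
    opNorm M ^ 2 ≤ ∑ i, ∑ j, M i j ^ 2 := by
  have hS : 0 ≤ ∑ i, ∑ j, M i j ^ 2 :=
    Finset.sum_nonneg fun i _ => Finset.sum_nonneg fun j _ => sq_nonneg _
  rw [← Real.le_sqrt (opNorm_nonneg M) hS]
  refine ContinuousLinearMap.opNorm_le_bound _ (Real.sqrt_nonneg _) fun x => ?_
  rw [EuclideanSpace.norm_eq, EuclideanSpace.norm_eq, ← Real.sqrt_mul hS]
  refine Real.sqrt_le_sqrt ?_
  rw [Finset.sum_mul]
  refine Finset.sum_le_sum fun i _ => ?_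
  have := Finset.sum_mul_sq_le_sq_mul_sq Finset.univ (fun j => M i j) (fun j => x j)
  simpa [Matrix.ofLp_toEuclideanCLM, Matrix.mulVec, dotProduct] using this

open scoped Matrix.Norms.L2Operator in
/-- For exponents that are powers of two this is the `C⋆`-identity; `2 ^ k` is such an exponent
above `k`, and submultiplicativity leads back to `k`. -/
lemma opNorm_pow_le_opNorm_pow {n : ℕ} {M : Matrix (Fin n) (Fin n) ℝ} (hM : M.IsSymm) (k : ℕ)
    (hk : 0 < k) : opNorm M ^ k ≤ opNorm (M ^ k) := by
  have hsa : IsSelfAdjoint M := by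
    rw [IsSelfAdjoint, Matrix.star_eq_conjTranspose, Matrix.conjTranspose_eq_transpose_of_trivial]
    exact hM
  rcases (opNorm_nonneg M).eq_or_lt with h0 | h0
  · rw [← h0, zero_pow hk.ne']; exact opNorm_nonneg _
  have hlt : k < 2 ^ k := Nat.lt_two_pow_self
  have h1 : opNorm (M ^ 2 ^ k) = opNorm M ^ 2 ^ k := by
    simp only [opNorm_eq_norm]
    exact hsa.norm_pow_two_pow k
  have h2 : opNorm (M ^ 2 ^ k) ≤ opNorm (M ^ k) * opNorm M ^ (2 ^ k - k) := by
    rw [← Nat.add_sub_of_le hlt.le, pow_add, Nat.add_sub_cancel_left]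
    exact (opNorm_mul_le _ _).trans
      (mul_le_mul_of_nonneg_left (opNorm_pow_le _ _ (by omega)) (opNorm_nonneg _))
  rw [h1, ← Nat.add_sub_of_le hlt.le, pow_add, Nat.add_sub_cancel_left] at h2
  exact le_of_mul_le_mul_right h2 (pow_pos h0 _)

/-- The even trace moments dominate the spectral norm of a symmetric matrix. -/
lemma opNorm_pow_le_trace {n : ℕ} {M : Matrix (Fin n) (Fin n) ℝ} (hM : M.IsSymm) (k : ℕ)
    (hk : 0 < k) : opNorm M ^ (2 * k) ≤ (M ^ (2 * k)).trace := by
  have h1 := pow_le_pow_left₀ (pow_nonneg (opNorm_nonneg M) k) (opNorm_pow_le_opNorm_pow hM k hk) 2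
  rw [← pow_mul, mul_comm k 2] at h1
  refine (h1.trans (opNorm_sq_le_sum_sq _)).trans_eq ?_
  have hs : (M ^ k).IsSymm := hM.pow k
  rw [two_mul, pow_add, Matrix.trace]
  refine Finset.sum_congr rfl fun i _ => ?_
  rw [Matrix.diag_apply, Matrix.mul_apply]
  refine Finset.sum_congr rfl fun j _ => ?_
  rw [hs.apply i j, sq]

lemma abs_apply_le_opNorm {n : ℕ} (M : Matrix (Fin n) (Fin n) ℝ) (i : Fin n) :
    |M i i| ≤ opNorm M := by
  have h := sum_mulVec_sq_le M (Pi.single i 1)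
  have h1 : ∑ j, (Pi.single i (1 : ℝ) : Fin n → ℝ) j ^ 2 = 1 := by
    simp [Pi.single_apply, ite_pow]
  rw [h1, mul_one] at h
  have h2 : M i i ^ 2 ≤ opNorm M ^ 2 := by
    refine le_trans ?_ h
    have := Finset.single_le_sum (f := fun j => (M.mulVec (Pi.single i 1) j) ^ 2)
      (fun j _ => sq_nonneg _) (Finset.mem_univ i)
    simpa using this
  exact abs_le_of_sq_le_sq h2 (opNorm_nonneg M)

lemma trace_pow_le {n : ℕ} (M : Matrix (Fin n) (Fin n) ℝ) (k : ℕ) (hk : 0 < k) :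
    (M ^ k).trace ≤ n * opNorm M ^ k := by
  rw [Matrix.trace]
  calc ∑ i, (M ^ k).diag i ≤ ∑ _i : Fin n, opNorm M ^ k :=
        Finset.sum_le_sum fun i _ => (le_abs_self _).trans
          ((abs_apply_le_opNorm _ i).trans (opNorm_pow_le M k hk))
    _ = n * opNorm M ^ k := by simp

/-- A maximal `1`-separated subset of the ball of radius `2`; it has at most `5 ^ n` points. -/
lemma exists_net (n : ℕ) : ∃ N : Finset (EuclideanSpace ℝ (Fin n)), N.card ≤ 5 ^ n ∧
    (∀ c ∈ N, ‖c‖ ≤ 2) ∧ ∀ x, ‖x‖ ≤ 2 → ∃ c ∈ N, ‖x - c‖ ≤ 1 := by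
  classical
  let p : Finset (EuclideanSpace ℝ (Fin n)) → Prop := fun s =>
    (∀ c ∈ s, ‖c‖ ≤ 2) ∧ ∀ c ∈ s, ∀ d ∈ s, c ≠ d → 1 ≤ ‖c - d‖
  have hcard : ∀ s, p s → s.card ≤ 5 ^ n := fun s hs => by
    simpa using Besicovitch.card_le_of_separated s hs.1 hs.2
  let q : ℕ → Prop := fun m => ∃ s, p s ∧ s.card = m
  have hq0 : q 0 := ⟨∅, by simp [p], rfl⟩
  obtain ⟨s, hs, hsc⟩ : q (Nat.findGreatest q (5 ^ n)) :=
    Nat.findGreatest_spec (Nat.zero_le _) hq0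
  refine ⟨s, hcard s hs, hs.1, fun x hx => ?_⟩
  by_contra! hfar
  have hxs : x ∉ s := fun h => by have := hfar x h; simp at this; linarith
  have hp : p (insert x s) := by
    refine ⟨fun c hc => ?_, fun c hc d hd hcd => ?_⟩
    · rcases Finset.mem_insert.1 hc with rfl | h
      exacts [hx, hs.1 c h]
    · rcases Finset.mem_insert.1 hc with rfl | h <;> rcases Finset.mem_insert.1 hd with rfl | h'
      · exact absurd rfl hcd
      · exact (hfar d h').le
      · rw [norm_sub_rev]; exact (hfar c h).le
      · exact hs.2 c h d h' hcd
  have h1 := hcard _ hp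
  have h2 : q (s.card + 1) := ⟨_, hp, Finset.card_insert_of_notMem hxs⟩
  rw [Finset.card_insert_of_notMem hxs] at h1
  have := Nat.le_findGreatest h1 h2
  omega

/-- The norm is tested on the net: the point of the net near `2 v / ‖v‖` loses at most half of
`2 ‖v‖`. -/
lemma norm_le_of_net {n : ℕ} {N : Finset (EuclideanSpace ℝ (Fin n))}
    (hN : ∀ x, ‖x‖ ≤ 2 → ∃ c ∈ N, ‖x - c‖ ≤ 1) (v : EuclideanSpace ℝ (Fin n)) {s : ℝ}
    (h : ∀ c ∈ N, inner ℝ c v ≤ s) (hs : 0 ≤ s) : ‖v‖ ≤ s := by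
  rcases eq_or_ne v 0 with rfl | hv
  · simpa
  have hv' : 0 < ‖v‖ := norm_pos_iff.2 hv
  obtain ⟨c, hc, hcv⟩ := hN ((2 / ‖v‖) • v) (by
    rw [norm_smul, Real.norm_of_nonneg (by positivity), div_mul_cancel₀ _ hv'.ne'])
  have h1 : inner ℝ ((2 / ‖v‖) • v) v = 2 * ‖v‖ := by
    rw [real_inner_smul_left, real_inner_self_eq_norm_sq]; field_simp
  have h2 : inner ℝ ((2 / ‖v‖) • v - c) v ≤ 1 * ‖v‖ :=
    (real_inner_le_norm _ _).trans (mul_le_mul_of_nonneg_right hcv hv'.le)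
  rw [inner_sub_left, h1] at h2
  linarith [h c hc]

/-- Discretization of the spectral norm on a net. -/
lemma opNorm_le_of_net {n : ℕ} {N : Finset (EuclideanSpace ℝ (Fin n))}
    (hN : ∀ x, ‖x‖ ≤ 2 → ∃ c ∈ N, ‖x - c‖ ≤ 1) (M : Matrix (Fin n) (Fin n) ℝ) {s : ℝ}
    (hs : 0 ≤ s) (h : ∀ c ∈ N, ∀ d ∈ N, c.ofLp ⬝ᵥ M.mulVec d.ofLp ≤ s) : opNorm M ≤ s := by
  have key : ∀ d ∈ N, ‖Matrix.toEuclideanCLM (n := Fin n) (𝕜 := ℝ) M d‖ ≤ s := fun d hd => by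
    refine norm_le_of_net hN _ (fun c hc => ?_) hs
    have := h c hc d hd
    rwa [EuclideanSpace.inner_eq_star_dotProduct, Matrix.ofLp_toEuclideanCLM, dotProduct_comm,
      star_trivial]
  have h2 : opNorm M ≤ (s + opNorm M) / 2 := by
    refine ContinuousLinearMap.opNorm_le_of_unit_norm (by have := opNorm_nonneg M; positivity)
      fun x hx => ?_
    obtain ⟨c, hc, hcx⟩ := hN ((2 : ℝ) • x) (by rw [norm_smul, hx]; norm_num)
    have h3 : ‖Matrix.toEuclideanCLM (n := Fin n) (𝕜 := ℝ) M ((2 : ℝ) • x)‖ ≤ s + opNorm M := by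
      calc _ = ‖Matrix.toEuclideanCLM (n := Fin n) (𝕜 := ℝ) M c +
            Matrix.toEuclideanCLM (n := Fin n) (𝕜 := ℝ) M ((2 : ℝ) • x - c)‖ := by
              rw [← map_add, add_sub_cancel]
        _ ≤ _ := norm_add_le _ _
        _ ≤ s + opNorm M := add_le_add (key c hc) ((ContinuousLinearMap.le_opNorm _ _).trans
            (mul_le_of_le_one_right (norm_nonneg _) hcx))
    rw [map_smul, norm_smul, Real.norm_ofNat] at h3
    linarith
  linarith

/-- The maximum over the net is bounded by a sum, so that expectations can be taken termwise. -/
lemma opNorm_pow_le_sum_net {n : ℕ} {N : Finset (EuclideanSpace ℝ (Fin n))}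
    (hN : ∀ x, ‖x‖ ≤ 2 → ∃ c ∈ N, ‖x - c‖ ≤ 1) (M : Matrix (Fin n) (Fin n) ℝ) {k : ℕ}
    (hk : 0 < k) :
    opNorm M ^ (2 * k) ≤ ∑ c ∈ N, ∑ d ∈ N, (c.ofLp ⬝ᵥ M.mulVec d.ofLp) ^ (2 * k) := by
  have hnn : ∀ z : ℝ, 0 ≤ z ^ (2 * k) := fun z => by rw [pow_mul]; positivity
  set T := ∑ c ∈ N, ∑ d ∈ N, (c.ofLp ⬝ᵥ M.mulVec d.ofLp) ^ (2 * k) with hT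
  have hT0 : 0 ≤ T := Finset.sum_nonneg fun c _ => Finset.sum_nonneg fun d _ => hnn _
  have hk' : (2 * k : ℕ) ≠ 0 := by omega
  have h : opNorm M ≤ T ^ (((2 * k : ℕ) : ℝ)⁻¹) := by
    refine opNorm_le_of_net hN M (Real.rpow_nonneg hT0 _) fun c hc d hd => ?_
    refine le_of_abs_le ?_
    rw [Real.le_rpow_inv_iff_of_pos (abs_nonneg _) hT0 (by positivity), Real.rpow_natCast,
      Even.pow_abs (by simp)]
    exact (Finset.single_le_sum (f := fun d => (c.ofLp ⬝ᵥ M.mulVec d.ofLp) ^ (2 * k))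
      (fun d _ => hnn _) hd).trans (Finset.single_le_sum
      (f := fun c => ∑ d ∈ N, (c.ofLp ⬝ᵥ M.mulVec d.ofLp) ^ (2 * k))
      (fun c _ => Finset.sum_nonneg fun d _ => hnn _) hc)
  rwa [Real.le_rpow_inv_iff_of_pos (opNorm_nonneg M) hT0 (by positivity), Real.rpow_natCast] at h

/-! ### Walks, their shapes, and counting of doubled closed walks -/

/-- The unordered pair traversed by the walk `w` at step `t`. -/
def stepEdge {V : Type*} {L : ℕ} (w : Fin (L + 1) → V) (t : Fin L) : Sym2 V :=
  s(w t.castSucc, w t.succ)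

/-- Closed walks that traverse each of their edges at least twice: every step `t` shares its edge
with another step `t'`. -/
def IsDoubled {V : Type*} {L : ℕ} (w : Fin (L + 1) → V) : Prop :=
  w 0 = w (Fin.last L) ∧ ∀ t, ∃ t', t' ≠ t ∧ stepEdge w t' = stepEdge w t

/-- The entries of matrix powers as sums over walks. -/
lemma pow_apply_eq_sum_walks {V : Type*} [Fintype V] [DecidableEq V] (M : Matrix V V ℝ) (L : ℕ)
    (a b : V) : (M ^ L) a b = ∑ w : Fin (L + 1) → V,
      if w 0 = a ∧ w (Fin.last L) = b then ∏ t : Fin L, M (w t.castSucc) (w t.succ) else 0 := by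
  induction L generalizing a with
  | zero =>
    rw [← (Equiv.funUnique (Fin 1) V).symm.sum_comp]
    simp [Matrix.one_apply, ite_and]
  | succ L ih =>
    rw [pow_succ', Matrix.mul_apply, ← (Fin.consEquiv fun _ : Fin (L + 2) => V).sum_comp,
      Fintype.sum_prod_type]
    simp only [ih, Finset.mul_sum]
    rw [Finset.sum_comm]
    conv_rhs => rw [Finset.sum_comm]
    refine Finset.sum_congr rfl fun w _ => ?_
    simp only [Fin.consEquiv_apply, Fin.cons_zero, ← Fin.succ_last, Fin.cons_succ,
      Fin.prod_univ_succ, Fin.castSucc_zero, ← Fin.succ_castSucc, ite_and]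
    simp

lemma trace_pow_eq_sum_walks {V : Type*} [Fintype V] [DecidableEq V] (M : Matrix V V ℝ) (L : ℕ) :
    (M ^ L).trace = ∑ w : Fin (L + 1) → V,
      if w 0 = w (Fin.last L) then ∏ t : Fin L, M (w t.castSucc) (w t.succ) else 0 := by
  simp only [Matrix.trace, Matrix.diag_apply, pow_apply_eq_sum_walks]
  rw [Finset.sum_comm]
  refine Finset.sum_congr rfl fun w _ => ?_
  simp [ite_and, eq_comm]

/-- A walk visits at most one more vertex than it has edges. -/
lemma card_image_le_card_edges {V : Type*} [DecidableEq V] {L : ℕ} (w : Fin (L + 1) → V) :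
    (Finset.univ.image w).card ≤ (Finset.univ.image (stepEdge w)).card + 1 := by
  induction L with
  | zero => simp
  | succ L ih =>
    have hv : Finset.univ.image w =
        insert (w (Fin.last _)) (Finset.univ.image fun i => w (Fin.castSucc i)) := by
      ext v; simp [Fin.exists_fin_succ', or_comm, eq_comm]
    have he : Finset.univ.image (stepEdge w) =
        insert (stepEdge w (Fin.last _))
          (Finset.univ.image (stepEdge fun i => w (Fin.castSucc i))) := by
      ext v; simp [Fin.exists_fin_succ', or_comm, eq_comm, stepEdge]
    have ih' := ih fun i => w (Fin.castSucc i)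
    rw [hv, he]
    by_cases hmem : w (Fin.last _) ∈ Finset.univ.image fun i => w (Fin.castSucc i)
    · rw [Finset.insert_eq_of_mem hmem]
      exact ih'.trans (Nat.succ_le_succ (Finset.card_le_card (Finset.subset_insert _ _)))
    · have hnot : stepEdge w (Fin.last _) ∉
          Finset.univ.image (stepEdge fun i => w (Fin.castSucc i)) := by
        intro h
        obtain ⟨t, -, ht⟩ := Finset.mem_image.1 h
        refine hmem ?_
        have : w (Fin.last _) ∈ stepEdge w (Fin.last L) := by simp [stepEdge]
        rw [← ht, stepEdge, Sym2.mem_iff] at this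
        rcases this with h | h
        · exact Finset.mem_image.2 ⟨_, Finset.mem_univ _, h.symm⟩
        · exact Finset.mem_image.2 ⟨_, Finset.mem_univ _, h.symm⟩
      rw [Finset.card_insert_of_notMem hmem, Finset.card_insert_of_notMem hnot]
      omega

/-- A closed walk of length `2 k` all of whose edges are traversed at least twice visits at most
`k + 1` vertices. -/
lemma IsDoubled.card_image_le {V : Type*} [DecidableEq V] {k : ℕ} {w : Fin (2 * k + 1) → V}
    (hw : IsDoubled w) : (Finset.univ.image w).card ≤ k + 1 := by
  have h1 : 2 * (Finset.univ.image (stepEdge w)).card ≤ 2 * k := by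
    have := Finset.mul_card_image_le_card (f := stepEdge w) Finset.univ 2
      (fun e he => by
        obtain ⟨t, -, rfl⟩ := Finset.mem_image.1 he
        obtain ⟨t', hne, ht'⟩ := hw.2 t
        exact Finset.one_lt_card.2 ⟨t', by simpa using ht', t, by simp, hne⟩)
    simpa using this
  have := card_image_le_card_edges w
  omega

section Shape

variable {ι U V : Type*} {L : ℕ}

/-- Being doubled depends only on the shape of a walk, that is, on which of its positions carry
equal vertices. -/
lemma IsDoubled.of_ker {w : Fin (L + 1) → V} {u : Fin (L + 1) → U}
    (h : ∀ s t, w s = w t ↔ u s = u t) (hw : IsDoubled w) : IsDoubled u := by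
  refine ⟨(h _ _).1 hw.1, fun t => ?_⟩
  obtain ⟨t', hne, ht'⟩ := hw.2 t
  refine ⟨t', hne, ?_⟩
  simp only [stepEdge, Sym2.eq_iff, h] at ht' ⊢
  exact ht'

lemma card_image_eq_of_ker [Fintype ι] [DecidableEq U] [DecidableEq V] {w : ι → V} {u : ι → U}
    (h : ∀ s t, w s = w t ↔ u s = u t) :
    (Finset.univ.image w).card = (Finset.univ.image u).card := by
  have hex : ∀ v ∈ Finset.univ.image w, ∃ s, w s = v := fun v hv => by
    simpa using hv
  rcases isEmpty_or_nonempty ι with hι | hι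
  · simp
  choose! σ hσ using hex
  refine Finset.card_bij (fun v _ => u (σ v)) (fun v _ => by simp) (fun v hv v' hv' hvv => ?_) ?_
  · rw [← hσ v hv, ← hσ v' hv']
    exact (h _ _).2 hvv
  · intro b hb
    obtain ⟨s, -, rfl⟩ := Finset.mem_image.1 hb
    exact ⟨w s, by simp, (h _ _).1 (hσ _ (by simp))⟩

/-- There are `|U| (|U| - 1) ⋯ (|U| - m + 1)` maps with the same shape as a map with `m` values. -/
lemma card_same_ker [Fintype ι] [DecidableEq ι] [Fintype U] [DecidableEq U] [DecidableEq V]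
    (w : ι → V) (p : (ι → U) → Prop) [DecidablePred p]
    (hp : ∀ u, p u ↔ ∀ s t, w s = w t ↔ u s = u t) :
    (Finset.univ.filter p).card =
      (Fintype.card U).descFactorial (Finset.univ.image w).card := by
  have hm : (Finset.univ.image w).card = Fintype.card (Finset.univ.image w) := by simp
  rw [hm, ← Fintype.card_embedding_eq, ← Finset.card_univ, eq_comm]
  refine Finset.card_bij (fun f _ s => f ⟨w s, by simp⟩) ?_ ?_ ?_
  · intro f _
    simp [hp]
  · intro f _ g _ h
    ext ⟨v, hv⟩
    obtain ⟨s, -, rfl⟩ := Finset.mem_image.1 hv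
    exact congrFun h s
  · intro u hu
    have hu := (hp u).1 (Finset.mem_filter.1 hu).2
    have hex : ∀ v : Finset.univ.image w, ∃ s, w s = v := fun v => by
      obtain ⟨s, -, hs⟩ := Finset.mem_image.1 v.2
      exact ⟨s, hs⟩
    choose σ hσ using hex
    refine ⟨⟨fun v => u (σ v), fun v v' hvv => ?_⟩, Finset.mem_univ _, ?_⟩
    · have := (hu _ _).2 hvv
      rw [hσ, hσ] at this
      exact Subtype.ext this
    · funext s
      exact (hu _ _).1 (hσ _)

end Shape

open Classical in
/-- Transfer of weighted walk counts between complete graphs: walks of the same shape are counted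
by falling factorials, and the weight `q ^ (m - 1)` of a shape with `m` vertices makes up for the
`n ^ (m - 1)` choices of all vertices but one, provided that `R` has room for `n * q` choices
besides the at most `k` vertices already visited. -/
lemma sum_isDoubled_le {n k R : ℕ} {q : ℝ} (hq : 0 ≤ q) (hR : k + 1 ≤ R)
    (hnq : n * q ≤ (R - k : ℕ)) :
    ∑ w : Fin (2 * k + 1) → Fin n,
      (if IsDoubled w then q ^ ((Finset.univ.image w).card - 1) else 0) ≤
      n * (Finset.univ.filter fun u : Fin (2 * k + 1) → Fin R => IsDoubled u).card := by
  set D : ℝ := ((R - k : ℕ) : ℝ) with hD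
  have hD1 : 1 ≤ D := by rw [hD]; exact_mod_cast (by omega : 1 ≤ R - k)
  -- `K w u` says that `w` and `u` have the same shape.
  let K : (Fin (2 * k + 1) → Fin n) → (Fin (2 * k + 1) → Fin R) → Prop := fun w u =>
    ∀ s t, w s = w t ↔ u s = u t
  -- The double sum of `F` over walks on `n` and on `R` vertices is estimated in both orders.
  let F : (Fin (2 * k + 1) → Fin n) → (Fin (2 * k + 1) → Fin R) → ℝ := fun w u =>
    if K w u ∧ IsDoubled u then
      q ^ ((Finset.univ.image u).card - 1) / D ^ (Finset.univ.image u).card else 0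
  calc _ ≤ ∑ w, ∑ u, F w u := by
        refine Finset.sum_le_sum fun w _ => ?_
        split_ifs with hw
        · set m := (Finset.univ.image w).card with hm
          have hF : ∀ u, F w u = if K w u then q ^ (m - 1) / D ^ m else 0 := fun u => by
            by_cases hK : K w u
            · simp only [F, hK, hw.of_ker hK, and_self, if_true, hm, card_image_eq_of_ker hK]
            · simp [F, hK]
          have hcard : D ^ m ≤ ((Finset.univ.filter (K w)).card : ℝ) := by
            rw [card_same_ker w (K w) fun u => Iff.rfl, Fintype.card_fin, ← hm]
            refine le_trans ?_ (Nat.cast_le.2 (Nat.pow_sub_le_descFactorial R m))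
            rw [Nat.cast_pow, hD]
            have := hw.card_image_le
            exact pow_le_pow_left₀ (Nat.cast_nonneg _) (Nat.cast_le.2 (by omega)) _
          simp only [hF]
          rw [← Finset.sum_filter, Finset.sum_const, nsmul_eq_mul, mul_div_assoc',
            le_div_iff₀ (by positivity), mul_comm]
          exact mul_le_mul_of_nonneg_right hcard (by positivity)
        · refine Finset.sum_nonneg fun u _ => ?_
          simp only [F]; split_ifs <;> positivity
    _ = ∑ u, ∑ w, F w u := Finset.sum_comm
    _ ≤ ∑ u : Fin (2 * k + 1) → Fin R, if IsDoubled u then (n : ℝ) else 0 := by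
        refine Finset.sum_le_sum fun u _ => ?_
        split_ifs with hu
        · set m := (Finset.univ.image u).card with hm
          have hm1 : 1 ≤ m := Finset.card_pos.2 ⟨u 0, by simp⟩
          have hcard : ((Finset.univ.filter fun w => K w u).card : ℝ) ≤ (n : ℝ) ^ m := by
            have : (Finset.univ.filter fun w => K w u).card = n.descFactorial m := by
              rw [card_same_ker u _ fun w => forall₂_congr fun s t => Iff.comm, Fintype.card_fin]
            rw [this]
            exact_mod_cast Nat.descFactorial_le_pow n m
          simp only [F, hu, and_true, ← hm]
          rw [← Finset.sum_filter, Finset.sum_const, nsmul_eq_mul]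
          clear_value m
          obtain ⟨j, rfl⟩ : ∃ j, m = j + 1 := ⟨m - 1, by omega⟩
          simp only [Nat.add_sub_cancel]
          rw [mul_div_assoc', div_le_iff₀ (by positivity)]
          calc _ ≤ (n : ℝ) ^ (j + 1) * q ^ j := mul_le_mul_of_nonneg_right hcard (by positivity)
            _ = n * (n * q) ^ j := by ring
            _ ≤ n * D ^ j := by gcongr
            -- One factor `D ≥ 1` is given away.
            _ ≤ n * D ^ (j + 1) := by gcongr; omega
        · simp only [F, hu, and_false, if_false, Finset.sum_const_zero, le_refl]
    _ = _ := by rw [← Finset.sum_filter, Finset.sum_const, nsmul_eq_mul, mul_comm]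

/-! ### The comparison ensemble -/

/-- The values of the comparison variable, which is uniform on `Fin 3`: it has mean `0`, and all
its moments of order at least `2` are at least `1`. -/
def xi (b : Fin 3) : ℝ := ![2, -1, -1] b

/-- The symmetric matrix with the values of `xi` at the labels `f`. -/
def xiMatrix {R : ℕ} (f : Sym2 (Fin R) → Fin 3) : Matrix (Fin R) (Fin R) ℝ :=
  Matrix.of fun i j => xi (f s(i, j))

lemma sum_xi_pow (m : ℕ) : ∑ b, xi b ^ m = 2 ^ m + 2 * (-1) ^ m := by
  simp [Fin.sum_univ_three, xi]; ring

lemma sum_xi_pow_ge {m : ℕ} (hm : m ≠ 1) : 3 ≤ ∑ b, xi b ^ m := by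
  rw [sum_xi_pow]
  rcases m.even_or_odd with h | h
  · rw [h.neg_one_pow]
    linarith [one_le_pow₀ (M₀ := ℝ) (a := 2) (by norm_num) (n := m)]
  · rw [h.neg_one_pow]
    have : 3 ≤ m := by obtain ⟨j, rfl⟩ := h; omega
    have := pow_le_pow_right₀ (a := (2 : ℝ)) (by norm_num) this
    linarith

lemma sum_xi_pow_nonneg (m : ℕ) : 0 ≤ ∑ b, xi b ^ m := by
  rcases eq_or_ne m 1 with rfl | h
  · rw [sum_xi_pow]; norm_num
  · linarith [sum_xi_pow_ge h]

lemma exp_le_add_exp_sq (x : ℝ) : Real.exp x ≤ x + Real.exp (x ^ 2) := by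
  rcases le_total |x| 1 with h | h
  · have h1 := (abs_le.1 (Real.abs_exp_sub_one_sub_id_le h)).2
    linarith [Real.add_one_le_exp (x ^ 2)]
  · rcases le_total 0 x with h0 | h0
    · rw [abs_of_nonneg h0] at h
      have : Real.exp x ≤ Real.exp (x ^ 2) := Real.exp_le_exp.2 (by nlinarith)
      linarith
    · rw [abs_of_nonpos h0] at h
      have : Real.exp x ≤ 1 := Real.exp_le_one_iff.2 h0
      nlinarith [Real.add_one_le_exp (x ^ 2)]

/-- The comparison variable is subgaussian: its mean is zero, so the linear terms of
`exp_le_add_exp_sq` cancel. -/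
lemma sum_exp_xi_le (t : ℝ) : ∑ b, Real.exp (t * xi b) ≤ 3 * Real.exp (4 * t ^ 2) := by
  have h1 := exp_le_add_exp_sq (t * 2)
  have h2 := exp_le_add_exp_sq (t * -1)
  have h3 : Real.exp ((t * -1) ^ 2) ≤ Real.exp (4 * t ^ 2) := Real.exp_le_exp.2 (by nlinarith)
  have h4 : Real.exp ((t * 2) ^ 2) = Real.exp (4 * t ^ 2) := by congr 1; ring
  simp only [Fin.sum_univ_three, xi, Matrix.cons_val_zero, Matrix.cons_val_one, Matrix.cons_val]
  linarith

/-- The weight of a walk as a product over edges, with multiplicities as exponents. -/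
lemma prod_walk_eq {V : Type*} [Fintype V] [DecidableEq V] {L : ℕ} (w : Fin (L + 1) → V)
    (Z : Sym2 V → ℝ) : ∏ t : Fin L, Z (stepEdge w t) =
      ∏ e, Z e ^ (Finset.univ.filter fun t => stepEdge w t = e).card := by
  rw [← Finset.prod_fiberwise_of_maps_to (t := Finset.univ) (g := stepEdge w) (by simp)]
  refine Finset.prod_congr rfl fun e _ => Finset.prod_eq_pow_card fun t ht => ?_
  rw [(Finset.mem_filter.1 ht).2]

open Classical in
/-- The trace moments of the comparison matrix dominate the number of doubled closed walks: each
such walk has expected weight at least `1`, and all other closed walks have nonnegative weight.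
Expectations over the labels are written as unnormalized sums. -/
lemma card_isDoubled_le_sum_trace (R L : ℕ) :
    ((Finset.univ.filter fun u : Fin (L + 1) → Fin R => IsDoubled u).card : ℝ) *
      3 ^ Fintype.card (Sym2 (Fin R)) ≤
      ∑ f : Sym2 (Fin R) → Fin 3, (xiMatrix f ^ L).trace := by
  simp only [trace_pow_eq_sum_walks]
  rw [Finset.sum_comm, Finset.card_eq_sum_ones, Finset.sum_filter, Nat.cast_sum, Finset.sum_mul]
  refine Finset.sum_le_sum fun u _ => ?_
  have hprod : ∑ f : Sym2 (Fin R) → Fin 3, ∏ t : Fin L, xiMatrix f (u t.castSucc) (u t.succ) =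
      ∏ e, ∑ b, xi b ^ (Finset.univ.filter fun t => stepEdge u t = e).card := by
    rw [Finset.prod_univ_sum, Fintype.piFinset_univ]
    refine Finset.sum_congr rfl fun f _ => ?_
    exact prod_walk_eq u fun e => xi (f e)
  by_cases hu : IsDoubled u
  · simp only [if_pos hu.1]
    rw [if_pos hu, hprod, Nat.cast_one, one_mul, ← Finset.card_univ,
      ← Finset.prod_const]
    refine Finset.prod_le_prod (fun _ _ => by norm_num) fun e _ => sum_xi_pow_ge fun h => ?_
    obtain ⟨t, ht⟩ := Finset.card_eq_one.1 h
    have hte : stepEdge u t = e := by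
      have : t ∈ Finset.univ.filter fun t => stepEdge u t = e := by rw [ht]; simp
      simpa using this
    obtain ⟨t', hne, ht'⟩ := hu.2 t
    have : t' ∈ Finset.univ.filter fun t => stepEdge u t = e := by simp [ht', hte]
    rw [ht] at this
    exact hne (by simpa using this)
  · rw [if_neg hu, Nat.cast_zero, zero_mul]
    split_ifs with h
    · rw [hprod]
      exact Finset.prod_nonneg fun e _ => sum_xi_pow_nonneg _
    · simp

/-- The coefficient at `e` of the bilinear form `x ⬝ᵥ M *ᵥ y` in a symmetric matrix `M`: the sum of
`x i * y j` over the one or two ordered pairs `(i, j)` underlying `e`. -/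
def bilinCoeff {R : ℕ} (x y : Fin R → ℝ) (e : Sym2 (Fin R)) : ℝ :=
  ∑ p : Fin R × Fin R with s(p.1, p.2) = e, x p.1 * y p.2

lemma dotProduct_xiMatrix {R : ℕ} (x y : Fin R → ℝ) (f : Sym2 (Fin R) → Fin 3) :
    x ⬝ᵥ (xiMatrix f).mulVec y = ∑ e, bilinCoeff x y e * xi (f e) := by
  have : x ⬝ᵥ (xiMatrix f).mulVec y =
      ∑ p : Fin R × Fin R, x p.1 * y p.2 * xi (f s(p.1, p.2)) := by
    rw [Fintype.sum_prod_type]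
    simp only [dotProduct, Matrix.mulVec, Finset.mul_sum, xiMatrix, Matrix.of_apply]
    exact Finset.sum_congr rfl fun i _ => Finset.sum_congr rfl fun j _ => by ring
  rw [this, ← Finset.sum_fiberwise_of_maps_to (t := Finset.univ)
    (g := fun p : Fin R × Fin R => s(p.1, p.2)) (by simp)]
  refine Finset.sum_congr rfl fun e _ => ?_
  rw [bilinCoeff, Finset.sum_mul]
  exact Finset.sum_congr rfl fun p hp => by rw [(Finset.mem_filter.1 hp).2]

lemma sum_bilinCoeff_sq_le {R : ℕ} (x y : Fin R → ℝ) :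
    ∑ e, bilinCoeff x y e ^ 2 ≤ 2 * ((∑ i, x i ^ 2) * ∑ j, y j ^ 2) := by
  have h : ∀ e, bilinCoeff x y e ^ 2 ≤
      2 * ∑ p : Fin R × Fin R with s(p.1, p.2) = e, (x p.1 * y p.2) ^ 2 := fun e => by
    refine sq_sum_le_card_mul_sum_sq.trans
      (mul_le_mul_of_nonneg_right ?_ (Finset.sum_nonneg fun _ _ => sq_nonneg _))
    induction e using Sym2.ind with
    | _ a b =>
      have : (Finset.univ.filter fun p : Fin R × Fin R => s(p.1, p.2) = s(a, b)) ⊆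
          {(a, b), (b, a)} := fun p hp => by
        simpa [Sym2.eq_iff, Prod.ext_iff] using hp
      exact_mod_cast (Finset.card_le_card this).trans Finset.card_le_two
  refine (Finset.sum_le_sum fun e _ => h e).trans_eq ?_
  rw [← Finset.mul_sum, Finset.sum_fiberwise_of_maps_to (by simp), Finset.sum_mul_sum,
    Fintype.sum_prod_type]
  simp only [mul_pow]

lemma sum_exp_bilin_le {R : ℕ} (x y : Fin R → ℝ) (l : ℝ) :
    ∑ f : Sym2 (Fin R) → Fin 3, Real.exp (l * (x ⬝ᵥ (xiMatrix f).mulVec y)) ≤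
      3 ^ Fintype.card (Sym2 (Fin R)) *
        Real.exp (8 * l ^ 2 * ((∑ i, x i ^ 2) * ∑ j, y j ^ 2)) := by
  have h1 : ∀ f : Sym2 (Fin R) → Fin 3, Real.exp (l * (x ⬝ᵥ (xiMatrix f).mulVec y)) =
      ∏ e, Real.exp (l * bilinCoeff x y e * xi (f e)) := fun f => by
    rw [dotProduct_xiMatrix, Finset.mul_sum, Real.exp_sum]
    exact Finset.prod_congr rfl fun e _ => by rw [mul_assoc]
  simp only [h1]
  rw [← Fintype.piFinset_univ, ← Finset.prod_univ_sum (fun _ => Finset.univ)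
    fun e b => Real.exp (l * bilinCoeff x y e * xi b)]
  calc _ ≤ ∏ e, 3 * Real.exp (4 * (l * bilinCoeff x y e) ^ 2) :=
        Finset.prod_le_prod (fun _ _ => Finset.sum_nonneg fun _ _ => (Real.exp_pos _).le)
          fun e _ => sum_exp_xi_le _
    _ = 3 ^ Fintype.card (Sym2 (Fin R)) * Real.exp (4 * l ^ 2 * ∑ e, bilinCoeff x y e ^ 2) := by
        rw [Finset.prod_mul_distrib, Finset.prod_const, Finset.card_univ, ← Real.exp_sum,
          Finset.mul_sum]
        simp only [mul_pow, mul_assoc]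
    _ ≤ _ := by
        refine mul_le_mul_of_nonneg_left (Real.exp_le_exp.2 ?_) (by positivity)
        nlinarith [sum_bilinCoeff_sq_le x y, sq_nonneg l]

lemma pow_le_factorial_mul_exp (z : ℝ) (k : ℕ) :
    z ^ (2 * k) ≤ (2 * k).factorial * (Real.exp z + Real.exp (-z)) := by
  have h := Real.pow_div_factorial_le_exp |z| (abs_nonneg z) (2 * k)
  rw [div_le_iff₀ (by positivity), Even.pow_abs (by simp)] at h
  have : Real.exp |z| ≤ Real.exp z + Real.exp (-z) := by
    rcases abs_cases z with ⟨h, -⟩ | ⟨h, -⟩ <;> rw [h] <;>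
      linarith [Real.exp_pos z, Real.exp_pos (-z)]
  calc _ ≤ _ := h
    _ ≤ _ := by rw [mul_comm]; gcongr

/-- Moments of order `2 k` of the comparison matrix's bilinear forms at vectors of norm at most `2`,
from the exponential moments at `± √k`. -/
lemma sum_bilin_pow_le {R k : ℕ} (hk : 0 < k) {x y : Fin R → ℝ} (hx : ∑ i, x i ^ 2 ≤ 4)
    (hy : ∑ i, y i ^ 2 ≤ 4) :
    ∑ f : Sym2 (Fin R) → Fin 3, (x ⬝ᵥ (xiMatrix f).mulVec y) ^ (2 * k) ≤
      3 ^ Fintype.card (Sym2 (Fin R)) * (2 * (4 * Real.exp 128 * k) ^ k) := by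
  have hk0 : (0 : ℝ) < k := by exact_mod_cast hk
  set N3 : ℝ := 3 ^ Fintype.card (Sym2 (Fin R))
  have hexp : ∀ l : ℝ, l ^ 2 = k →
      ∑ f : Sym2 (Fin R) → Fin 3, Real.exp (l * (x ⬝ᵥ (xiMatrix f).mulVec y)) ≤
        N3 * Real.exp 128 ^ k := fun l hl => by
    refine (sum_exp_bilin_le x y l).trans ?_
    rw [← Real.exp_nat_mul, hl]
    refine mul_le_mul_of_nonneg_left (Real.exp_le_exp.2 ?_) (by positivity)
    have : (∑ i, x i ^ 2) * ∑ j, y j ^ 2 ≤ 4 * 4 :=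
      mul_le_mul hx hy (Finset.sum_nonneg fun _ _ => sq_nonneg _) (by norm_num)
    nlinarith
  have h1 := hexp (√k) (Real.sq_sqrt hk0.le)
  have h2 := hexp (-√k) (by rw [neg_sq, Real.sq_sqrt hk0.le])
  have h3 : ∀ f : Sym2 (Fin R) → Fin 3,
      (k : ℝ) ^ k * (x ⬝ᵥ (xiMatrix f).mulVec y) ^ (2 * k) ≤
        (2 * k : ℕ) ^ (2 * k) * (Real.exp (√k * (x ⬝ᵥ (xiMatrix f).mulVec y)) +
          Real.exp (-√k * (x ⬝ᵥ (xiMatrix f).mulVec y))) := fun f => by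
    have := pow_le_factorial_mul_exp (√k * (x ⬝ᵥ (xiMatrix f).mulVec y)) k
    rw [mul_pow, pow_mul, Real.sq_sqrt hk0.le, ← neg_mul] at this
    refine this.trans (mul_le_mul_of_nonneg_right ?_ (by positivity))
    exact_mod_cast Nat.factorial_le_pow (2 * k)
  have h4 := Finset.sum_le_sum fun f (_ : f ∈ Finset.univ) => h3 f
  rw [← Finset.mul_sum, ← Finset.mul_sum, Finset.sum_add_distrib] at h4
  have h5 : (k : ℝ) ^ k * ∑ f : Sym2 (Fin R) → Fin 3, (x ⬝ᵥ (xiMatrix f).mulVec y) ^ (2 * k) ≤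
      (k : ℝ) ^ k * (N3 * (2 * (4 * Real.exp 128 * k) ^ k)) := by
    refine h4.trans ?_
    calc _ ≤ ((2 * k : ℕ) : ℝ) ^ (2 * k) * (N3 * Real.exp 128 ^ k + N3 * Real.exp 128 ^ k) := by
          gcongr
      _ = _ := by
          push_cast
          rw [pow_mul, mul_pow, mul_pow, mul_pow, mul_pow, ← pow_mul (k : ℝ), mul_comm 2 k, pow_mul]
          norm_num
          ring
  exact le_of_mul_le_mul_left h5 (by positivity)

open Classical in
/-- Bound on the number of doubled closed walks on `R` vertices, useful for `R` of order `k`. The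
factor `100 ^ R` stems from the `25 ^ R` pairs of points of a net and from the factor `2 R`. -/
lemma card_isDoubled_le {R k : ℕ} (hk : 0 < k) :
    ((Finset.univ.filter fun u : Fin (2 * k + 1) → Fin R => IsDoubled u).card : ℝ) ≤
      100 ^ R * (4 * Real.exp 128 * k) ^ k := by
  obtain ⟨N, hcard, hN2, hN⟩ := exists_net R
  set N3 : ℝ := 3 ^ Fintype.card (Sym2 (Fin R)) with hN3
  set T : ℝ := (4 * Real.exp 128 * k) ^ k with hT
  have hT0 : 0 ≤ T := by positivity
  have hN30 : 0 < N3 := by positivity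
  have hsq : ∀ c ∈ N, ∑ i, c.ofLp i ^ 2 ≤ 4 := fun c hc => by
    have := pow_le_pow_left₀ (norm_nonneg _) (hN2 c hc) 2
    rw [EuclideanSpace.norm_sq_eq] at this
    norm_num at this
    exact this
  have h1 : ∑ f : Sym2 (Fin R) → Fin 3, opNorm (xiMatrix f) ^ (2 * k) ≤
      N3 * ((N.card : ℝ) ^ 2 * (2 * T)) := by
    calc _ ≤ ∑ f : Sym2 (Fin R) → Fin 3, ∑ c ∈ N, ∑ d ∈ N,
          (c.ofLp ⬝ᵥ (xiMatrix f).mulVec d.ofLp) ^ (2 * k) :=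
          Finset.sum_le_sum fun f _ => opNorm_pow_le_sum_net hN _ hk
      _ = ∑ c ∈ N, ∑ d ∈ N, ∑ f : Sym2 (Fin R) → Fin 3,
          (c.ofLp ⬝ᵥ (xiMatrix f).mulVec d.ofLp) ^ (2 * k) := by
          rw [Finset.sum_comm]
          exact Finset.sum_congr rfl fun c _ => Finset.sum_comm
      _ ≤ ∑ c ∈ N, ∑ d ∈ N, N3 * (2 * T) :=
          Finset.sum_le_sum fun c hc => Finset.sum_le_sum fun d hd =>
            sum_bilin_pow_le hk (hsq c hc) (hsq d hd)
      _ = _ := by simp only [Finset.sum_const, nsmul_eq_mul]; ring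
  have h2 := card_isDoubled_le_sum_trace R (2 * k)
  have h3 : ∑ f : Sym2 (Fin R) → Fin 3, (xiMatrix f ^ (2 * k)).trace ≤
      R * ∑ f : Sym2 (Fin R) → Fin 3, opNorm (xiMatrix f) ^ (2 * k) := by
    rw [Finset.mul_sum]
    exact Finset.sum_le_sum fun f _ => trace_pow_le _ _ (by omega)
  have h4 : (R : ℝ) * ((N.card : ℝ) ^ 2 * (2 * T)) ≤ 100 ^ R * T := by
    have hR : (2 : ℝ) * R ≤ 4 ^ R := by
      have : 2 * R ≤ 4 ^ R := by
        rcases Nat.eq_zero_or_pos R with rfl | hR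
        · simp
        · have h2 : 2 ≤ 2 ^ R := by simpa using Nat.pow_le_pow_right (n := 2) (by norm_num) hR
          calc 2 * R ≤ 2 ^ R * 2 ^ R := Nat.mul_le_mul h2 Nat.lt_two_pow_self.le
            _ = 4 ^ R := by rw [← mul_pow]; rfl
      exact_mod_cast this
    have hN : (N.card : ℝ) ^ 2 ≤ 25 ^ R := by
      calc (N.card : ℝ) ^ 2 ≤ (5 ^ R) ^ 2 := by gcongr; exact_mod_cast hcard
        _ = 25 ^ R := by rw [← pow_mul, mul_comm, pow_mul]; norm_num
    calc _ = (2 * R) * (N.card : ℝ) ^ 2 * T := by ring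
      _ ≤ 4 ^ R * 25 ^ R * T := by gcongr
      _ = 100 ^ R * T := by rw [← mul_pow]; norm_num
  refine le_of_mul_le_mul_right ?_ hN30
  calc _ ≤ _ := h2
    _ ≤ _ := h3
    _ ≤ R * (N3 * ((N.card : ℝ) ^ 2 * (2 * T))) := by gcongr
    _ = N3 * (R * ((N.card : ℝ) ^ 2 * (2 * T))) := by ring
    _ ≤ N3 * (100 ^ R * T) := by gcongr
    _ = _ := by ring

/-! ### Moments of matrices with independent centred entries -/

/-- The symmetric matrix with zero diagonal and entries `Y` at the pairs `i < j`. -/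
def symmMatrix {n : ℕ} (Y : Pair n → ℝ) : Matrix (Fin n) (Fin n) ℝ :=
  Matrix.of fun i j =>
    if h : i < j then Y ⟨(i, j), h⟩ else if h : j < i then Y ⟨(j, i), h⟩ else 0

lemma symmMatrix_of_lt {n : ℕ} (Y : Pair n → ℝ) {i j : Fin n} (h : i < j) :
    symmMatrix Y i j = Y ⟨(i, j), h⟩ := by
  simp [symmMatrix, h]

lemma symmMatrix_of_gt {n : ℕ} (Y : Pair n → ℝ) {i j : Fin n} (h : j < i) :
    symmMatrix Y i j = Y ⟨(j, i), h⟩ := by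
  simp [symmMatrix, h, h.not_gt]

lemma symmMatrix_self {n : ℕ} (Y : Pair n → ℝ) (i : Fin n) : symmMatrix Y i i = 0 := by
  simp [symmMatrix]

lemma symmMatrix_isSymm {n : ℕ} (Y : Pair n → ℝ) : (symmMatrix Y).IsSymm := by
  refine Matrix.IsSymm.ext fun i j => ?_
  rcases lt_trichotomy i j with h | rfl | h
  · rw [symmMatrix_of_lt Y h, symmMatrix_of_gt Y h]
  · rfl
  · rw [symmMatrix_of_lt Y h, symmMatrix_of_gt Y h]

lemma exists_pair_of_ne {n : ℕ} {i j : Fin n} (h : i ≠ j) :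
    ∃ e : Pair n, s(e.1.1, e.1.2) = s(i, j) ∧ ∀ Y : Pair n → ℝ, symmMatrix Y i j = Y e := by
  rcases h.lt_or_gt with h | h
  · exact ⟨⟨(i, j), h⟩, rfl, fun Y => symmMatrix_of_lt Y h⟩
  · exact ⟨⟨(j, i), h⟩, Sym2.eq_swap, fun Y => symmMatrix_of_gt Y h⟩

lemma pair_sym2_injective {n : ℕ} :
    Function.Injective fun e : Pair n => (s(e.1.1, e.1.2) : Sym2 (Fin n)) := by
  rintro ⟨⟨a, b⟩, hab⟩ ⟨⟨c, d⟩, hcd⟩ h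
  simp only [Sym2.eq_iff] at h hab hcd
  rcases h with ⟨rfl, rfl⟩ | ⟨rfl, rfl⟩
  · rfl
  · exact absurd hab hcd.not_gt

section Moments

variable {n L : ℕ} {ν : Pair n → Measure (Bool × Bool)} [∀ e, IsProbabilityMeasure (ν e)]
  {g : Pair n → Bool × Bool → ℝ} {q : ℝ}

/-- The expected weight of a walk in a matrix with independent centred entries vanishes if some
edge is traversed only once, and each edge contributes at most a factor `q` otherwise. -/
lemma abs_integral_prod_walk_le (hq0 : 0 ≤ q) (hq1 : q ≤ 1) (hmean : ∀ e, ∫ b, g e b ∂ν e = 0)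
    (hmom : ∀ e m, 2 ≤ m → |∫ b, g e b ^ m ∂ν e| ≤ 2 ^ m * q) (w : Fin (L + 1) → Fin n)
    [Decidable (∀ t, ∃ t', t' ≠ t ∧ stepEdge w t' = stepEdge w t)] :
    |∫ x, ∏ t : Fin L, symmMatrix (fun e => g e (x e)) (w t.castSucc) (w t.succ) ∂Measure.pi ν| ≤
      if ∀ t, ∃ t', t' ≠ t ∧ stepEdge w t' = stepEdge w t then
        2 ^ L * q ^ ((Finset.univ.image w).card - 1) else 0 := by
  classical
  have hR : 0 ≤ if ∀ t, ∃ t', t' ≠ t ∧ stepEdge w t' = stepEdge w t then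
      2 ^ L * q ^ ((Finset.univ.image w).card - 1) else 0 := by split_ifs <;> positivity
  by_cases hloop : ∃ t : Fin L, w t.castSucc = w t.succ
  · obtain ⟨t, ht⟩ := hloop
    have : ∀ x : Pair n → Bool × Bool,
        ∏ t : Fin L, symmMatrix (fun e => g e (x e)) (w t.castSucc) (w t.succ) = 0 := fun x =>
      Finset.prod_eq_zero (Finset.mem_univ t) (by rw [ht, symmMatrix_self])
    simpa [this] using hR
  push Not at hloop
  choose π hπ hY using fun t => exists_pair_of_ne (hloop t)
  set mult : Pair n → ℕ := fun e => (Finset.univ.filter fun t => π t = e).card with hmult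
  have hint : ∫ x, ∏ t : Fin L, symmMatrix (fun e => g e (x e)) (w t.castSucc) (w t.succ)
      ∂Measure.pi ν = ∏ e, ∫ b, g e b ^ mult e ∂ν e := by
    rw [← integral_fintype_prod_eq_prod (fun e b => g e b ^ mult e)]
    congr 1
    ext x
    simp only [hY]
    rw [← Finset.prod_fiberwise_of_maps_to (t := Finset.univ) (g := π) (by simp)]
    refine Finset.prod_congr rfl fun e _ => Finset.prod_eq_pow_card fun t ht => ?_
    rw [(Finset.mem_filter.1 ht).2]
  have hker : ∀ t t', π t' = π t ↔ stepEdge w t' = stepEdge w t := fun t t' => by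
    rw [stepEdge, stepEdge, ← hπ, ← hπ]
    exact pair_sym2_injective.eq_iff.symm
  rw [hint]
  split_ifs with hd
  · rw [Finset.abs_prod]
    have hmult2 : ∀ e ∈ Finset.univ.image π, 2 ≤ mult e := fun e he => by
      obtain ⟨t, -, rfl⟩ := Finset.mem_image.1 he
      obtain ⟨t', hne, ht'⟩ := hd t
      exact Finset.one_lt_card.2 ⟨t', by simpa [hker] using ht', t, by simp, hne⟩
    have hbound : ∀ e, |∫ b, g e b ^ mult e ∂ν e| ≤
        2 ^ mult e * if e ∈ Finset.univ.image π then q else 1 := fun e => by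
      split_ifs with he
      · exact hmom e _ (hmult2 e he)
      · have : mult e = 0 := Finset.card_eq_zero.2 (Finset.filter_eq_empty_iff.2 fun t _ h =>
          he (Finset.mem_image.2 ⟨t, Finset.mem_univ _, h⟩))
        simp [this]
    refine (Finset.prod_le_prod (fun _ _ => abs_nonneg _) fun e _ => hbound e).trans ?_
    rw [Finset.prod_mul_distrib, Finset.prod_pow_eq_pow_sum, Finset.prod_ite_mem,
      Finset.univ_inter, Finset.prod_const]
    have hsum : ∑ e, mult e = L := by
      rw [hmult, ← Finset.card_eq_sum_card_fiberwise (by simp)]; simp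
    rw [hsum]
    refine mul_le_mul_of_nonneg_left (pow_le_pow_of_le_one hq0 hq1 ?_) (by positivity)
    rw [card_image_eq_of_ker (u := stepEdge w) fun s t => hker t s]
    have := card_image_le_card_edges w
    omega
  · push Not at hd
    obtain ⟨t, ht⟩ := hd
    have h1 : mult (π t) = 1 := Finset.card_eq_one.2 ⟨t, by
      ext t'
      simp only [Finset.mem_filter, Finset.mem_univ, true_and, Finset.mem_singleton]
      refine ⟨fun h => ?_, fun h => by rw [h]⟩
      by_contra hne
      exact ht t' hne ((hker _ _).1 h)⟩
    rw [Finset.prod_eq_zero (Finset.mem_univ (π t)) (by rw [h1]; simpa using hmean _), abs_zero]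

/-- Moment bound for the spectral norm of a symmetric matrix with independent centred entries whose
moments are controlled by `q`, obtained by comparison with a matrix of dimension `R`. -/
lemma integral_opNorm_pow_le {k R : ℕ} (hk : 0 < k) (hq0 : 0 ≤ q) (hq1 : q ≤ 1)
    (hmean : ∀ e, ∫ b, g e b ∂ν e = 0)
    (hmom : ∀ e m, 2 ≤ m → |∫ b, g e b ^ m ∂ν e| ≤ 2 ^ m * q)
    (hR : k + 1 ≤ R) (hnq : n * q ≤ (R - k : ℕ)) :
    ∫ x, opNorm (symmMatrix fun e => g e (x e)) ^ (2 * k) ∂Measure.pi ν ≤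
      n * (100 ^ R * (16 * Real.exp 128 * k) ^ k) := by
  classical
  calc ∫ x, opNorm (symmMatrix fun e => g e (x e)) ^ (2 * k) ∂Measure.pi ν
      ≤ ∫ x, (symmMatrix (fun e => g e (x e)) ^ (2 * k)).trace ∂Measure.pi ν :=
        integral_mono .of_finite .of_finite fun x =>
          opNorm_pow_le_trace (symmMatrix_isSymm _) k hk
    _ = ∑ w : Fin (2 * k + 1) → Fin n, if w 0 = w (Fin.last _) then
          ∫ x, ∏ t : Fin (2 * k), symmMatrix (fun e => g e (x e)) (w t.castSucc) (w t.succ)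
            ∂Measure.pi ν else 0 := by
        simp only [trace_pow_eq_sum_walks]
        rw [integral_finsetSum _ fun _ _ => .of_finite]
        refine Finset.sum_congr rfl fun w _ => ?_
        split_ifs <;> simp
    _ ≤ ∑ w : Fin (2 * k + 1) → Fin n, 2 ^ (2 * k) *
          (if IsDoubled w then q ^ ((Finset.univ.image w).card - 1) else 0) := by
        refine Finset.sum_le_sum fun w _ => ?_
        have h := (le_abs_self _).trans (abs_integral_prod_walk_le hq0 hq1 hmean hmom w)
        by_cases h0 : w 0 = w (Fin.last _)
        · rw [if_pos h0]
          refine h.trans_eq ?_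
          simp only [IsDoubled, h0, true_and, mul_ite, mul_zero]
        · simp [IsDoubled, h0]
    _ ≤ 2 ^ (2 * k) * (n * (100 ^ R * (4 * Real.exp 128 * k) ^ k)) := by
        rw [← Finset.mul_sum]
        refine mul_le_mul_of_nonneg_left ((sum_isDoubled_le hq0 hR hnq).trans ?_) (by positivity)
        exact mul_le_mul_of_nonneg_left (card_isDoubled_le hk) (Nat.cast_nonneg _)
    _ = _ := by
        rw [pow_mul, show (16 : ℝ) * Real.exp 128 * k = 2 ^ 2 * (4 * Real.exp 128 * k) by ring,
          mul_pow (2 ^ 2 : ℝ)]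
        ring

end Moments

section Bernoulli

variable (p s : unitInterval)

/-- The joint law of the two independent indicators of one pair of nodes. -/
noncomputable abbrev pairLaw : Measure (Bool × Bool) :=
  (bernoulliMeasure true false p).prod (bernoulliMeasure true false s)

lemma integral_pairLaw (φ : Bool × Bool → ℝ) : ∫ b, φ b ∂pairLaw p s =
    p * (s * φ (true, true) + (1 - s) * φ (true, false)) +
      (1 - p) * (s * φ (false, true) + (1 - s) * φ (false, false)) := by
  rw [integral_prod _ .of_finite]
  simp [integral_bernoulliMeasure]

variable {p s} {φ : Bool × Bool → ℝ}

lemma abs_integral_pairLaw_le_one (hφ : ∀ b, |φ b| ≤ if b.1 then 1 else 0) :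
    |∫ b, φ b ∂pairLaw p s| ≤ 1 := by
  have h : ∀ b, ‖φ b‖ ≤ 1 := fun b => (hφ b).trans (by split_ifs <;> norm_num)
  simpa using norm_integral_le_of_norm_le_const (μ := pairLaw p s)
    (Filter.Eventually.of_forall h)

lemma integral_centered_pairLaw :
    ∫ b, (φ b - ∫ b, φ b ∂pairLaw p s) ∂pairLaw p s = 0 := by
  rw [integral_sub .of_finite .of_finite]; simp

/-- Moments of a centred variable that vanishes off the event that the edge is present. -/
lemma abs_integral_centered_pow_le (hφ : ∀ b, |φ b| ≤ if b.1 then 1 else 0) {m : ℕ} (hm : 2 ≤ m) :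
    |∫ b, (φ b - ∫ b, φ b ∂pairLaw p s) ^ m ∂pairLaw p s| ≤ 2 ^ m * p := by
  set a := ∫ b, φ b ∂pairLaw p s with ha
  have hsq : ∫ b, (φ b - a) ^ 2 ∂pairLaw p s ≤ p := by
    have h1 : ∫ b, (φ b - a) ^ 2 ∂pairLaw p s = ∫ b, φ b ^ 2 ∂pairLaw p s - a ^ 2 := by
      have : ∀ b, (φ b - a) ^ 2 = φ b ^ 2 - 2 * a * φ b + a ^ 2 := fun b => by ring
      simp only [this]
      rw [integral_add .of_finite .of_finite, integral_sub .of_finite .of_finite,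
        integral_const_mul, ← ha]
      simp; ring
    have h2 : ∫ b, φ b ^ 2 ∂pairLaw p s ≤ ∫ b, (if b.1 then 1 else 0) ∂pairLaw p s := by
      refine integral_mono .of_finite .of_finite fun b => ?_
      have := pow_le_pow_left₀ (abs_nonneg _) (hφ b) 2
      rw [sq_abs] at this
      refine this.trans_eq ?_
      by_cases h : b.1 <;> simp [h]
    have h3 : ∫ b : Bool × Bool, (if b.1 then 1 else 0 : ℝ) ∂pairLaw p s = p := by
      rw [integral_pairLaw]; simp
    linarith [sq_nonneg a]
  have hle : ∀ b, |φ b - a| ≤ 2 := fun b => by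
    have h1 := abs_sub (φ b) a
    have h2 : |a| ≤ 1 := abs_integral_pairLaw_le_one hφ
    have h3 : |φ b| ≤ 1 := (hφ b).trans (by split_ifs <;> norm_num)
    linarith
  calc |∫ b, (φ b - a) ^ m ∂pairLaw p s| ≤ ∫ b, |(φ b - a) ^ m| ∂pairLaw p s :=
        abs_integral_le_integral_abs
    _ ≤ ∫ b, 2 ^ m * (φ b - a) ^ 2 ∂pairLaw p s := by
        refine integral_mono .of_finite .of_finite fun b => ?_
        obtain ⟨j, rfl⟩ := Nat.exists_eq_add_of_le hm
        simp only
        rw [pow_add, abs_mul, abs_of_nonneg (sq_nonneg (φ b - a)), abs_pow, mul_comm]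
        refine mul_le_mul_of_nonneg_right ?_ (sq_nonneg _)
        calc |φ b - a| ^ j ≤ 2 ^ j := pow_le_pow_left₀ (abs_nonneg _) (hle b) j
          _ ≤ 2 ^ (2 + j) := pow_le_pow_right₀ (by norm_num) (by omega)
    _ = 2 ^ m * ∫ b, (φ b - a) ^ 2 ∂pairLaw p s := integral_const_mul _ _
    _ ≤ _ := by gcongr

end Bernoulli

/-! ### Concentration of the adjacency matrices -/

instance {n : ℕ} (P S : Matrix (Fin n) (Fin n) unitInterval) :
    IsProbabilityMeasure (indicatorLaw P S) := by
  unfold indicatorLaw; infer_instance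

/-- The symmetric matrix with zero diagonal whose entry at the pair `e` is `φ (x e) - E φ (x e)`. -/
noncomputable def centeredMatrix {n : ℕ} (P S : Matrix (Fin n) (Fin n) unitInterval)
    (φ : Bool × Bool → ℝ) (x : Pair n → Bool × Bool) : Matrix (Fin n) (Fin n) ℝ :=
  symmMatrix fun e => φ (x e) - ∫ b, φ b ∂pairLaw (P e.1.1 e.1.2) (S e.1.1 e.1.2)

/-- Markov's inequality for the moment of order `2 k`, with comparison dimension `(κ + 2) k`. -/
lemma measure_opNorm_centeredMatrix_le {n k κ : ℕ} (hk : 0 < k)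
    {P S : Matrix (Fin n) (Fin n) unitInterval}
    {φ : Bool × Bool → ℝ} (hφ : ∀ b, |φ b| ≤ if b.1 then 1 else 0) (hn : 0 < n)
    (hP : ∀ i j, (n : ℝ) * P i j ≤ κ * k) {B : ℝ} (hB : 0 < B) :
    (indicatorLaw P S).real {x | B * (16 * 100 ^ (κ + 2) * Real.exp 128) * k <
      opNorm (centeredMatrix P S φ x) ^ 2} ≤ n / B ^ k := by
  have hn0 : (0 : ℝ) < n := by exact_mod_cast hn
  have hk0 : (0 : ℝ) < k := by exact_mod_cast hk
  -- The minimum with `1` ensures that powers of `q` decrease.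
  set q : ℝ := min 1 (κ * k / n) with hq
  have hPq : ∀ i j, (P i j : ℝ) ≤ q := fun i j =>
    le_min (P i j).2.2 (by rw [le_div_iff₀ hn0, mul_comm]; exact hP i j)
  have hmoment : ∫ x, opNorm (centeredMatrix P S φ x) ^ (2 * k) ∂indicatorLaw P S ≤
      n * (100 ^ ((κ + 2) * k) * (16 * Real.exp 128 * k) ^ k) := by
    refine integral_opNorm_pow_le (q := q)
      (ν := fun e : Pair n => pairLaw (P e.1.1 e.1.2) (S e.1.1 e.1.2))
      (g := fun e b => φ b - ∫ b, φ b ∂pairLaw (P e.1.1 e.1.2) (S e.1.1 e.1.2)) hk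
      (by positivity) (min_le_left _ _) (fun e => integral_centered_pairLaw)
      (fun e m hm => (abs_integral_centered_pow_le hφ hm).trans ?_) ?_ ?_
    · exact mul_le_mul_of_nonneg_left (hPq _ _) (by positivity)
    · nlinarith [Nat.zero_le (κ * k)]
    · have h1 : (κ + 2) * k - k = κ * k + k := by
        rw [add_mul, two_mul]; omega
      rw [h1]
      push_cast
      calc (n : ℝ) * q ≤ n * (κ * k / n) := by gcongr; exact min_le_right _ _
        _ = κ * k := by field_simp
        _ ≤ κ * k + k := by linarith
  set K : ℝ := 16 * 100 ^ (κ + 2) * Real.exp 128 with hK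
  have hK0 : 0 < K := by positivity
  have hmarkov := mul_meas_ge_le_integral_of_nonneg (μ := indicatorLaw P S)
    (f := fun x => opNorm (centeredMatrix P S φ x) ^ (2 * k))
    (Filter.Eventually.of_forall fun x => pow_nonneg (opNorm_nonneg _) _) .of_finite
    ((B * K * k) ^ k)
  have hsub : {x | B * K * k < opNorm (centeredMatrix P S φ x) ^ 2} ⊆
      {x | (B * K * k) ^ k ≤ opNorm (centeredMatrix P S φ x) ^ (2 * k)} := fun x hx => by
    rw [Set.mem_ofPred_eq, pow_mul]
    exact pow_le_pow_left₀ (by positivity) (le_of_lt hx) k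
  refine (measureReal_mono hsub).trans ?_
  have hfin := hmarkov.trans hmoment
  have h2 : (n : ℝ) * (100 ^ ((κ + 2) * k) * (16 * Real.exp 128 * k) ^ k) = n * (K * k) ^ k := by
    rw [pow_mul, ← mul_pow, hK]; ring_nf
  rw [h2, mul_assoc, mul_pow] at hfin
  rw [le_div_iff₀ (by positivity)]
  refine le_of_mul_le_mul_right ?_ (show 0 < (K * k) ^ k by positivity)
  refine (le_of_eq ?_).trans hfin
  ring_nf

lemma abs_entry (b : Bool × Bool) : |entry b| = if b.1 then 1 else 0 := by
  rcases b with ⟨_ | _, _ | _⟩ <;> norm_num [entry]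

lemma abs_adjacency {n : ℕ} (x : Pair n → Bool × Bool) (i j : Fin n) :
    |adjacency x i j| = symmMatrix (fun e => |entry (x e)|) i j := by
  simp only [adjacency, symmMatrix, Matrix.of_apply]
  split_ifs <;> simp

lemma centeredMatrix_apply {n : ℕ} {P S : Matrix (Fin n) (Fin n) unitInterval}
    (φ : Bool × Bool → ℝ) (x : Pair n → Bool × Bool) (i j : Fin n) :
    centeredMatrix P S φ x i j = symmMatrix (fun e => φ (x e)) i j -
      symmMatrix (fun e : Pair n => ∫ b, φ b ∂pairLaw (P e.1.1 e.1.2) (S e.1.1 e.1.2)) i j := by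
  simp only [centeredMatrix, symmMatrix, Matrix.of_apply]
  split_ifs <;> simp

lemma centeredMatrix_entry {n : ℕ} {P S : Matrix (Fin n) (Fin n) unitInterval}
    (h : Admissible P S) (x : Pair n → Bool × Bool) :
    centeredMatrix P S entry x = adjacency x - meanAdjacency P S := by
  ext i j
  rw [centeredMatrix_apply, Matrix.sub_apply]
  congr 1
  have hint : ∀ p s : unitInterval, ∫ b, entry b ∂pairLaw p s = p * (1 - 2 * s) := fun p s => by
    rw [integral_pairLaw]; simp [entry]; left; ring
  simp only [hint, meanAdjacency, Matrix.of_apply]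
  rcases lt_trichotomy i j with hij | rfl | hij
  · rw [symmMatrix_of_lt _ hij]
  · simp [symmMatrix_self, h.diag_edge]
  · rw [symmMatrix_of_gt _ hij, h.symm_edge.apply i j, h.symm_sign.apply i j]

lemma centeredMatrix_abs_entry {n : ℕ} {P S : Matrix (Fin n) (Fin n) unitInterval}
    (h : Admissible P S) (x : Pair n → Bool × Bool) (i j : Fin n) :
    centeredMatrix P S (fun b => |entry b|) x i j = |adjacency x i j| - P i j := by
  rw [centeredMatrix_apply, abs_adjacency]
  congr 1
  have hint : ∀ p s : unitInterval, ∫ b, |entry b| ∂pairLaw p s = p := fun p s => by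
    rw [integral_pairLaw]; simp [abs_entry]
  simp only [hint]
  rcases lt_trichotomy i j with hij | rfl | hij
  · rw [symmMatrix_of_lt _ hij]
  · simp [symmMatrix_self, h.diag_edge]
  · rw [symmMatrix_of_gt _ hij, h.symm_edge.apply i j]

/-! ### From adjacency matrices to normalized Laplacians -/

lemma abs_inv_sub_inv_le {a b m : ℝ} (hm : 0 < m) (ha : m ≤ a) (hb : m ≤ b) :
    |a⁻¹ - b⁻¹| ≤ |a ^ 2 - b ^ 2| / (2 * m ^ 3) := by
  have ha0 := hm.trans_le ha
  have hb0 := hm.trans_le hb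
  have h1 : a⁻¹ - b⁻¹ = -(a ^ 2 - b ^ 2) / (a * b * (a + b)) := by
    field_simp; ring
  rw [h1, abs_div, abs_neg, abs_of_pos (show 0 < a * b * (a + b) by positivity)]
  refine div_le_div_of_nonneg_left (abs_nonneg _) (by positivity) ?_
  calc 2 * m ^ 3 = m * m * (m + m) := by ring
    _ ≤ a * b * (a + b) := by gcongr

/-- The difference of two normalized Laplacians: one term for the change of the matrix, one for
the change of the degrees. -/
lemma normalizedLaplacian_sub {n : ℕ} {d d' : Fin n → ℝ} (hd : ∀ i, 0 < d i) (hd' : ∀ i, 0 < d' i)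
    (A A' : Matrix (Fin n) (Fin n) ℝ) :
    normalizedLaplacian d A - normalizedLaplacian d' A' =
      -(Matrix.diagonal (fun i => (√(d i))⁻¹) * (A - A') * Matrix.diagonal (fun i => (√(d i))⁻¹) +
        Matrix.of fun i j => A' i j * ((√(d i) * √(d j))⁻¹ - (√(d' i) * √(d' j))⁻¹)) := by
  have hone : ∀ x : ℝ, 0 < x → (√x)⁻¹ * x * (√x)⁻¹ = 1 := fun x hx => by
    have := Real.sq_sqrt hx.le
    have := Real.sqrt_pos.2 hx
    field_simp
    linarith
  ext i j
  simp only [normalizedLaplacian, Matrix.sub_apply, Matrix.diagonal_mul, Matrix.mul_diagonal,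
    Matrix.neg_apply, Matrix.add_apply, Matrix.of_apply, mul_inv]
  by_cases hij : i = j
  · subst hij
    simp only [Matrix.diagonal_apply_eq]
    linear_combination hone _ (hd i) - hone _ (hd' i)
  · simp only [Matrix.diagonal_apply_ne _ hij]
    ring

/-- Deterministic perturbation bound: the matrix term of `normalizedLaplacian_sub` is bounded in
spectral norm, the degree term in Hilbert–Schmidt norm. -/
lemma opNorm_normalizedLaplacian_sub_le {n : ℕ} (hn : 0 < n) {d d' : Fin n → ℝ} {m Δ α T V : ℝ}
    (hm : 0 < m) (hd : ∀ i, m ≤ d i) (hd' : ∀ i, m ≤ d' i) (hdΔ : ∀ i, d i ≤ Δ)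
    (hd'Δ : ∀ i, d' i ≤ Δ) {A A' : Matrix (Fin n) (Fin n) ℝ} (hα : 0 ≤ α)
    (hA' : ∀ i j, (n : ℝ) * |A' i j| ≤ α) (hT : opNorm (A - A') ≤ T) (hV0 : 0 ≤ V)
    (hV : ∑ i, (d i - d' i) ^ 2 ≤ n * V ^ 2) :
    opNorm (normalizedLaplacian d A - normalizedLaplacian d' A') ≤
      T / m + α * Δ * V / m ^ 3 := by
  have hn0 : (0 : ℝ) < n := by exact_mod_cast hn
  have hΔ : 0 ≤ Δ := (hm.trans_le ((hd ⟨0, hn⟩).trans (hdΔ _))).le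
  rw [normalizedLaplacian_sub (fun i => hm.trans_le (hd i)) (fun i => hm.trans_le (hd' i)),
    opNorm_neg]
  refine (opNorm_add_le _ _).trans (add_le_add ?_ ?_)
  · have hU : opNorm (Matrix.diagonal fun i => (√(d i))⁻¹) ≤ (√m)⁻¹ := by
      refine opNorm_diagonal_le _ (by positivity) fun i => ?_
      rw [abs_of_nonneg (by positivity)]
      exact inv_anti₀ (Real.sqrt_pos.2 hm) (Real.sqrt_le_sqrt (hd i))
    calc _ ≤ opNorm (Matrix.diagonal fun i => (√(d i))⁻¹) * opNorm (A - A') *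
          opNorm (Matrix.diagonal fun i => (√(d i))⁻¹) :=
          (opNorm_mul_le _ _).trans
            (mul_le_mul_of_nonneg_right (opNorm_mul_le _ _) (opNorm_nonneg _))
      _ ≤ (√m)⁻¹ * T * (√m)⁻¹ := by
          have := opNorm_nonneg (A - A')
          have := opNorm_nonneg (Matrix.diagonal fun i => (√(d i))⁻¹)
          gcongr
          exact mul_nonneg (by positivity) (by linarith)
      _ = T / m := by
          rw [mul_right_comm, ← mul_inv, Real.mul_self_sqrt hm.le]; ring
  · refine abs_le_of_sq_le_sq' ?_ (by positivity) |>.2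
    refine (opNorm_sq_le_sum_sq _).trans ?_
    have hentry : ∀ i j, (Matrix.of (fun i j =>
          A' i j * ((√(d i) * √(d j))⁻¹ - (√(d' i) * √(d' j))⁻¹)) i j) ^ 2 ≤
        (α / n) ^ 2 * (Δ ^ 2 * ((d i - d' i) ^ 2 + (d j - d' j) ^ 2)) / (2 * m ^ 6) := by
      intro i j
      have hs : ∀ x y : ℝ, m ≤ x → m ≤ y → m ≤ √x * √y := fun x y hx hy => by
        rw [← Real.sqrt_mul (hm.le.trans hx), Real.le_sqrt hm.le (by nlinarith)]
        nlinarith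
      have hss : ∀ x y : ℝ, m ≤ x → m ≤ y → (√x * √y) ^ 2 = x * y := fun x y hx hy => by
        rw [mul_pow, Real.sq_sqrt (hm.le.trans hx), Real.sq_sqrt (hm.le.trans hy)]
      have h1 := abs_inv_sub_inv_le hm (hs _ _ (hd i) (hd j)) (hs _ _ (hd' i) (hd' j))
      rw [hss _ _ (hd i) (hd j), hss _ _ (hd' i) (hd' j)] at h1
      have h2 : (d i * d j - d' i * d' j) ^ 2 ≤
          2 * (Δ ^ 2 * ((d i - d' i) ^ 2 + (d j - d' j) ^ 2)) := by
        have e : d i * d j - d' i * d' j = (d i - d' i) * d j + d' i * (d j - d' j) := by ring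
        have hj : d j ^ 2 ≤ Δ ^ 2 := pow_le_pow_left₀ (hm.le.trans (hd j)) (hdΔ j) 2
        have hi : d' i ^ 2 ≤ Δ ^ 2 := pow_le_pow_left₀ (hm.le.trans (hd' i)) (hd'Δ i) 2
        rw [e]
        refine (add_sq_le).trans ?_
        rw [mul_pow, mul_pow]
        nlinarith [mul_le_mul_of_nonneg_left hj (sq_nonneg (d i - d' i)),
          mul_le_mul_of_nonneg_left hi (sq_nonneg (d j - d' j))]
      have h3 : |A' i j| ≤ α / n := by rw [le_div_iff₀ hn0, mul_comm]; exact hA' i j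
      rw [Matrix.of_apply, ← sq_abs, abs_mul, mul_pow]
      calc _ ≤ (α / n) ^ 2 * (|d i * d j - d' i * d' j| / (2 * m ^ 3)) ^ 2 := by gcongr
        _ = (α / n) ^ 2 * (d i * d j - d' i * d' j) ^ 2 / (4 * m ^ 6) := by
            rw [div_pow |_|, sq_abs]; ring
        _ ≤ (α / n) ^ 2 * (2 * (Δ ^ 2 * ((d i - d' i) ^ 2 + (d j - d' j) ^ 2))) / (4 * m ^ 6) := by
            gcongr
        _ = _ := by ring
    calc _ ≤ ∑ i, ∑ j,
          (α / n) ^ 2 * (Δ ^ 2 * ((d i - d' i) ^ 2 + (d j - d' j) ^ 2)) / (2 * m ^ 6) :=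
          Finset.sum_le_sum fun i _ => Finset.sum_le_sum fun j _ => hentry i j
      _ = (α / n) ^ 2 * (Δ ^ 2 * (n * ∑ i, (d i - d' i) ^ 2)) / m ^ 6 := by
          simp only [← Finset.sum_div, ← Finset.mul_sum, Finset.sum_add_distrib,
            Finset.sum_const, Finset.card_univ, Fintype.card_fin, nsmul_eq_mul]
          ring
      _ ≤ (α / n) ^ 2 * (Δ ^ 2 * (n * (n * V ^ 2))) / m ^ 6 := by gcongr
      _ = (α * Δ * V / m ^ 3) ^ 2 := by field_simp

/-- The vector of degree deviations is the image of the all-ones vector under the deviation `F` of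
the unsigned adjacency matrix. -/
lemma sum_degree_sub_sq_le {n : ℕ} {P : Matrix (Fin n) (Fin n) unitInterval}
    {A F : Matrix (Fin n) (Fin n) ℝ} (hF : ∀ i j, F i j = |A i j| - P i j) :
    ∑ i, (degree A i - meanDegree P i) ^ 2 ≤ n * opNorm F ^ 2 := by
  have := sum_mulVec_sq_le F fun _ => 1
  simp only [Matrix.mulVec, dotProduct, mul_one, hF, Finset.sum_sub_distrib, one_pow,
    Finset.sum_const, Finset.card_univ, Fintype.card_fin, nsmul_eq_mul] at this
  rw [mul_comm]
  exact this

/-- Since the entries of `|A|` are `0` or `1`, a degree is the squared norm of a column of `|A|`. -/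
lemma degree_le {n : ℕ} {P : Matrix (Fin n) (Fin n) unitInterval} (hP : P.IsSymm)
    {A F : Matrix (Fin n) (Fin n) ℝ} (hF : ∀ i j, F i j = |A i j| - P i j) (hA : A.IsSymm)
    (hA01 : ∀ i j, |A i j| ^ 2 = |A i j|) (i : Fin n) :
    degree A i ≤ 2 * opNorm F ^ 2 + 2 * meanDegree P i := by
  have h := sum_mulVec_sq_le F (Pi.single i 1)
  have h1 : ∑ j, (Pi.single i (1 : ℝ) : Fin n → ℝ) j ^ 2 = 1 := by
    simp [Pi.single_apply, ite_pow]
  rw [h1, mul_one] at h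
  have h2 : ∀ j, |A i j| ≤ 2 * (F.mulVec (Pi.single i 1) j) ^ 2 + 2 * P i j := fun j => by
    have e : F.mulVec (Pi.single i 1) j = |A i j| - P i j := by
      simp [hF, hA.apply i j, hP.apply i j]
    rw [e]
    have h0 := (P i j).2.1
    have h1 := (P i j).2.2
    nlinarith [sq_nonneg (|A i j| - 2 * P i j), hA01 i j]
  calc degree A i ≤ ∑ j, (2 * (F.mulVec (Pi.single i 1) j) ^ 2 + 2 * (P i j : ℝ)) :=
        Finset.sum_le_sum fun j _ => h2 j
    _ = 2 * ∑ j, (F.mulVec (Pi.single i 1) j) ^ 2 + 2 * meanDegree P i := by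
        rw [Finset.sum_add_distrib, ← Finset.mul_sum, ← Finset.mul_sum, meanDegree]
    _ ≤ _ := by linarith

lemma adjacency_isSymm {n : ℕ} (x : Pair n → Bool × Bool) : (adjacency x).IsSymm :=
  symmMatrix_isSymm fun e => entry (x e)

lemma abs_adjacency_sq {n : ℕ} (x : Pair n → Bool × Bool) (i j : Fin n) :
    |adjacency x i j| ^ 2 = |adjacency x i j| := by
  rw [abs_adjacency]
  simp only [symmMatrix, Matrix.of_apply, abs_entry]
  split_ifs <;> norm_num

/-- The event that both adjacency matrices are close to their means controls the Laplacian. -/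
lemma opNorm_laplacian_sub_le {n : ℕ} (hn : 0 < n) {P S : Matrix (Fin n) (Fin n) unitInterval}
    (h : Admissible P S) {α b H : ℝ} (hα : 1 ≤ α) (hb : 0 ≤ b) (hH : 0 ≤ H)
    (hP : ∀ i j, (n : ℝ) * P i j ≤ b * α)
    (hmean : ∀ i j, (n : ℝ) * |meanAdjacency P S i j| ≤ α) (x : Pair n → Bool × Bool)
    (h1 : opNorm (centeredMatrix P S entry x) ^ 2 ≤ H * α)
    (h2 : opNorm (centeredMatrix P S (fun b => |entry b|) x) ^ 2 ≤ H * α)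
    (hpos : 0 < min (minDegree (adjacency x)) (minMeanDegree P)) :
    opNorm (laplacian (adjacency x) - meanLaplacian P S) ≤
      (√H * (b ^ 2 + (2 * H + 2 * b))) * α ^ (5 / 2 : ℝ) /
        min (minDegree (adjacency x)) (minMeanDegree P) ^ 3 := by
  set m := min (minDegree (adjacency x)) (minMeanDegree P) with hm
  have hn0 : (0 : ℝ) < n := by exact_mod_cast hn
  have hα0 : 0 ≤ α := by linarith
  have hbα : 0 ≤ b * α := mul_nonneg hb hα0
  have hd : ∀ i, m ≤ degree (adjacency x) i := fun i =>
    (min_le_left _ _).trans (ciInf_le (Set.finite_range _).bddBelow i)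
  have hd' : ∀ i, m ≤ meanDegree P i := fun i =>
    (min_le_right _ _).trans (ciInf_le (Set.finite_range _).bddBelow i)
  have hmd : ∀ i, meanDegree P i ≤ b * α := fun i => by
    calc meanDegree P i ≤ ∑ _j : Fin n, b * α / n :=
          Finset.sum_le_sum fun j _ => by rw [le_div_iff₀ hn0, mul_comm]; exact hP i j
      _ = b * α := by simp; field_simp
  have hmb : m ≤ b * α := (hd' ⟨0, hn⟩).trans (hmd _)
  have hF := centeredMatrix_abs_entry h x
  have hsqrt : ∀ y : ℝ, 0 ≤ y → y ^ 2 ≤ H * α → y ≤ √(H * α) := fun y _ hy =>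
    Real.le_sqrt_of_sq_le hy
  have key := opNorm_normalizedLaplacian_sub_le hn (Δ := (2 * H + 2 * b) * α) (α := α)
    (T := √(H * α)) (V := √(H * α)) hpos hd hd'
    (fun i => by
      have := degree_le h.symm_edge hF (adjacency_isSymm x) (abs_adjacency_sq x) i
      nlinarith [hmd i])
    (fun i => (hmd i).trans (by nlinarith [hbα, mul_nonneg hH hα0]))
    hα0 hmean (by
      rw [← centeredMatrix_entry h x]
      exact hsqrt _ (opNorm_nonneg _) h1) (Real.sqrt_nonneg _) (by
      rw [Real.sq_sqrt (by positivity)]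
      exact (sum_degree_sub_sq_le hF).trans (mul_le_mul_of_nonneg_left h2 hn0.le))
  refine key.trans ?_
  have hpow : α ^ (5 / 2 : ℝ) = α ^ 2 * √α := by
    rw [show (5 / 2 : ℝ) = 2 + 1 / 2 by norm_num, Real.rpow_add (by linarith), Real.sqrt_eq_rpow]
    norm_num
  rw [hpow, Real.sqrt_mul hH]
  -- The first term has the required order because `m ≤ b * α`.
  have hT : √H * √α / m ≤ √H * b ^ 2 * (α ^ 2 * √α) / m ^ 3 := by
    rw [div_le_div_iff₀ hpos (by positivity)]
    calc √H * √α * m ^ 3 = √H * √α * m * m ^ 2 := by ring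
      _ ≤ √H * √α * m * (b * α) ^ 2 := by gcongr
      _ = _ := by ring
  calc _ ≤ √H * b ^ 2 * (α ^ 2 * √α) / m ^ 3 +
        α * ((2 * H + 2 * b) * α) * (√H * √α) / m ^ 3 := by gcongr
    _ = _ := by ring

end SignedER

theorem theorem3p5 (c₀ c₁ r : ℝ) (hc₀ : 0 < c₀) (hc₁ : 0 < c₁) (hr : 0 < r) :
    ∃ C : ℝ, 0 < C ∧ ∃ N : ℕ, ∀ n : ℕ, 2 ≤ n → N ≤ n →
      ∀ (P S : Matrix (Fin n) (Fin n) unitInterval), SignedER.Admissible P S →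
      (∀ i j, c₀ < |(S i j : ℝ) - 1 / 2|) →
      ∀ α : ℝ, c₁ * Real.log n ≤ α →
      (∀ i j, (n : ℝ) * |SignedER.meanAdjacency P S i j| ≤ α) →
      ∀ (Ω : Type*) [MeasurableSpace Ω] (μ : Measure Ω) [IsProbabilityMeasure μ]
        (A : Ω → Matrix (Fin n) (Fin n) ℝ),
      HasLaw A (SignedER.model P S) μ →
      1 - (n : ℝ) ^ (-r) ≤
        μ.real {ω |
          0 < min (SignedER.minDegree (A ω)) (SignedER.minMeanDegree P) →
          SignedER.opNorm (SignedER.laplacian (A ω) - SignedER.meanLaplacian P S) ≤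
            C * α ^ (5 / 2 : ℝ) /
              min (SignedER.minDegree (A ω)) (SignedER.minMeanDegree P) ^ 3} := by
  obtain ⟨κ, hκ⟩ := exists_nat_ge (1 / (2 * c₀))
  set b : ℝ := 1 / (2 * c₀) with hb
  have hb0 : 0 < b := by positivity
  set B : ℝ := Real.exp ((r + 2) / c₁) with hB
  set K : ℝ := 16 * 100 ^ (κ + 2) * Real.exp 128 with hK
  set H : ℝ := 2 * (B * K) with hH
  have hB0 : 0 < B := Real.exp_pos _
  have hK0 : 0 < K := by positivity
  have hH0 : 0 < H := by positivity
  -- For `n ≥ exp (1 / c₁)` one has `α ≥ 1`, hence `⌈α⌉ ≤ 2 α`.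
  obtain ⟨N, hN⟩ := exists_nat_ge (Real.exp (1 / c₁))
  refine ⟨√H * (b ^ 2 + (2 * H + 2 * b)), by positivity, N, ?_⟩
  intro n hn2 hnN P S hPS hS α hαlog hmean Ω _ μ _ A hA
  have hn0 : (0 : ℝ) < n := by exact_mod_cast (by omega : 0 < n)
  have hn2' : (2 : ℝ) ≤ n := by exact_mod_cast hn2
  have hα1 : 1 ≤ α := by
    have h1 : 1 / c₁ ≤ Real.log n := by
      rw [Real.le_log_iff_exp_le hn0]
      exact hN.trans (by exact_mod_cast hnN)
    rw [div_le_iff₀ hc₁] at h1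
    linarith
  -- The sign condition bounds the edge probabilities by the entries of the mean matrix.
  have hP : ∀ i j, (n : ℝ) * P i j ≤ b * α := fun i j => by
    have h1 : |SignedER.meanAdjacency P S i j| = P i j * (2 * |(S i j : ℝ) - 1 / 2|) := by
      have e : SignedER.meanAdjacency P S i j = P i j * (-2 * ((S i j : ℝ) - 1 / 2)) := by
        simp only [SignedER.meanAdjacency, Matrix.of_apply]; ring
      rw [e, abs_mul, abs_mul, abs_of_nonneg (P i j).2.1]; norm_num
    have h2 : (n : ℝ) * (P i j * (2 * c₀)) ≤ α := by
      refine le_trans ?_ (hmean i j)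
      rw [h1]
      have := (P i j).2.1
      gcongr
      exact (hS i j).le
    rw [hb, div_mul_eq_mul_div, one_mul, le_div_iff₀ (by positivity)]
    linarith
  set k : ℕ := ⌈α⌉₊ with hk
  have hk0 : 0 < k := Nat.ceil_pos.2 (by linarith)
  have hαk : α ≤ k := Nat.le_ceil α
  have hkα : (k : ℝ) ≤ 2 * α := by linarith [Nat.ceil_lt_add_one (show 0 ≤ α by linarith)]
  -- With `k ≥ c₁ log n`, the factor `n / B ^ k` from Markov's inequality is at most `n ^ (-r) / 2`.
  have htail : n / B ^ k ≤ (n : ℝ) ^ (-r) / 2 := by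
    have h1 : (n : ℝ) ^ (r + 2) ≤ B ^ k := by
      rw [hB, ← Real.exp_nat_mul, Real.rpow_def_of_pos hn0]
      refine Real.exp_le_exp.2 ?_
      rw [mul_div_assoc', le_div_iff₀ hc₁]
      nlinarith
    have h2 : (n : ℝ) ^ (r + 2) = n ^ r * (n * n) := by
      rw [Real.rpow_add hn0]; norm_num [sq]
    rw [Real.rpow_neg hn0.le, ← one_div, div_div, div_le_div_iff₀ (by positivity) (by positivity)]
    have h3 : 0 < (n : ℝ) ^ r := by positivity
    nlinarith [mul_le_mul_of_nonneg_left hn2' (mul_pos h3 hn0).le]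
  have hevent : ∀ φ : Bool × Bool → ℝ, (∀ b, |φ b| ≤ if b.1 then 1 else 0) →
      (SignedER.indicatorLaw P S).real
        {x | H * α < SignedER.opNorm (SignedER.centeredMatrix P S φ x) ^ 2} ≤
        (n : ℝ) ^ (-r) / 2 := fun φ hφ => by
    refine (measureReal_mono fun x hx => ?_).trans
      ((SignedER.measure_opNorm_centeredMatrix_le hk0 hφ (by omega)
        (fun i j => (hP i j).trans (by gcongr)) hB0).trans htail)
    rw [Set.mem_ofPred_eq] at hx ⊢
    refine lt_of_le_of_lt ?_ hx
    calc B * K * k ≤ B * K * (2 * α) := by gcongr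
      _ = H * α := by rw [hH]; ring
  set bad₁ := {x | H * α < SignedER.opNorm (SignedER.centeredMatrix P S SignedER.entry x) ^ 2}
  set bad₂ := {x | H * α <
    SignedER.opNorm (SignedER.centeredMatrix P S (fun b => |SignedER.entry b|) x) ^ 2}
  have hbad : (SignedER.indicatorLaw P S).real (bad₁ ∪ bad₂) ≤ (n : ℝ) ^ (-r) := by
    refine (measureReal_union_le _ _).trans ?_
    have h1 := hevent SignedER.entry fun b => (SignedER.abs_entry b).le
    have h2 := hevent (fun b => |SignedER.entry b|) fun b => by
      rw [abs_abs]; exact (SignedER.abs_entry b).le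
    linarith
  have hgood : 1 - (n : ℝ) ^ (-r) ≤ (SignedER.indicatorLaw P S).real (bad₁ ∪ bad₂)ᶜ := by
    rw [probReal_compl_eq_one_sub (Set.toFinite _).measurableSet]
    linarith
  -- The image of the good event is a finite, hence measurable, set of matrices.
  have : MeasurableSingletonClass (Matrix (Fin n) (Fin n) ℝ) :=
    inferInstanceAs (MeasurableSingletonClass (Fin n → Fin n → ℝ))
  set G : Set (Matrix (Fin n) (Fin n) ℝ) := SignedER.adjacency '' (bad₁ ∪ bad₂)ᶜ
  have hG : MeasurableSet G := ((Set.toFinite _).image _).measurableSet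
  have hlaw : μ.real (A ⁻¹' G) = (SignedER.model P S).real G := by
    rw [← hA.map_eq, map_measureReal_apply_of_aemeasurable hA.aemeasurable hG]
  have hmodel : (SignedER.indicatorLaw P S).real (bad₁ ∪ bad₂)ᶜ ≤ (SignedER.model P S).real G := by
    rw [SignedER.model, map_measureReal_apply (measurable_of_finite _) hG]
    exact measureReal_mono (Set.subset_preimage_image _ _)
  refine (hgood.trans (hmodel.trans_eq hlaw.symm)).trans (measureReal_mono fun ω hω => ?_)
  obtain ⟨x, hx, hxω⟩ := hω
  rw [Set.mem_ofPred_eq, ← hxω]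
  simp only [Set.compl_union, Set.mem_inter_iff, Set.mem_compl_iff, bad₁, bad₂, Set.mem_ofPred_eq,
    not_lt] at hx
  exact SignedER.opNorm_laplacian_sub_le (by omega) hPS hα1 hb0.le hH0.le hP hmean x hx.1 hx.2
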